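/- All rings are commutative with 1, and no Noetherian assumption is made. An ideal is *regular* if it contains a nonzerodivisor; it is *stable* if it is projective as a module over its ring of endomorphisms. A ring is *stable* (resp. *finitely stable*) if each of its regular (resp. finitely generated regular) ideals is stable. An extension of rings $R\subseteq S$ is *quadratic* if $xy\in xR+yR+R$ for all $x,y\in S$. Let $Q(R)$ be the total ring of quotients of $R$ and $\overline R$ the integral closure of $R$ in $Q(R)$. A *Dedekind ring* is a ring in which every regular ideal is invertible. For a local ring $R$ (i.e. a ring with a unique maximal ideal) whose maximal ideal is regular put $R_0=R$, $R_{i+1}=\{q\in Q(R): q\,\mathrm{Jac}(R_i)\subseteq \mathrm{Jac}(R_i)\}$ for $i\ge 0$, and $R_\infty=\bigcup_i R_i$, where $\mathrm{Jac}$ denotes the Jacobson radical; $R$ is a *quadratic ring* if its maximal ideal is stable and $R\subseteq R_\infty$ is a quadratic extension. **Theorem.** Let $R$ be a local ring of Krull dimension one with regular maximal ideal $M$, let $m\in M$ be a nonzerodivisor, and let $J=\bigcap_{i>0}m^iR$. Then the following are equivalent: 1. $R$ is a stable ring; 2. $R$ is a finitely stable ring and its maximal ideal $M$ is stable; 3.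 $R$ is a quadratic ring and $\overline R$ has at most two maximal ideals; 4. $R\subseteq\overline R$ is a quadratic extension and $\overline R$ is a Dedekind ring with at most two maximal ideals; 5. $R/J$ is a stable ring. -/

import Mathlib

/-- An ideal is regular if it contains a nonzerodivisor. -/
def IsRegularIdeal {R : Type*} [CommRing R] (I : Ideal R) : Prop :=
  ∃ x ∈ I, x ∈ nonZeroDivisors R

/-- An ideal is stable if it is projective as a module over its ring of endomorphisms. -/
def IsStableIdeal {R : Type*} [CommRing R] (I : Ideal R) : Prop :=
  Module.Projective (Module.End R I) I

/-- A ring is stable if every regular ideal is stable. -/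
def IsStableRing (R : Type*) [CommRing R] : Prop :=
  ∀ I : Ideal R, IsRegularIdeal I → IsStableIdeal I

/-- A ring is finitely stable if every finitely generated regular ideal is stable. -/
def IsFinitelyStableRing (R : Type*) [CommRing R] : Prop :=
  ∀ I : Ideal R, I.FG → IsRegularIdeal I → IsStableIdeal I

/-- The extension `R ⊆ S` is quadratic if `x y ∈ x R + y R + R` for all `x, y ∈ S`. -/
def IsQuadraticExtension (R S : Type*) [CommRing R] [CommRing S] [Algebra R S] : Prop :=
  ∀ x y : S, ∃ a b c : R, x * y = a • x + b • y + algebraMap R S c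

/-- A Dedekind ring (zero divisors allowed): every regular ideal is invertible, that is, a unit in
the monoid of fractional ideals in the total ring of quotients. -/
def IsDedekindRegular (A : Type*) [CommRing A] : Prop :=
  ∀ I : Ideal A, IsRegularIdeal I →
    IsUnit (I : FractionalIdeal (nonZeroDivisors A) (FractionRing A))

/-- The ring `A` has at most two maximal ideals. -/
def HasAtMostTwoMaximalIdeals (A : Type*) [CommRing A] : Prop :=
  {N : Ideal A | N.IsMaximal}.encard ≤ 2

/-- The ring `E(N) = {q ∈ Q : q N ⊆ N}`. -/
def multiplierRing {R Q : Type*} [CommRing R] [CommRing Q] [Algebra R Q]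
    (N : Submodule R Q) : Subalgebra R Q where
  carrier := {q | ∀ x ∈ N, q * x ∈ N}
  mul_mem' := fun {a b} ha hb x hx => by
    rw [mul_assoc]
    exact ha _ (hb x hx)
  add_mem' := fun {a b} ha hb x hx => by
    rw [add_mul]
    exact N.add_mem (ha x hx) (hb x hx)
  algebraMap_mem' := fun r x hx => by
    rw [← Algebra.smul_def]
    exact N.smul_mem r hx

/-- The Jacobson radical of a ring `A` with `R ⊆ A ⊆ Q`, as a subset of `Q`. -/
def jacobsonRadicalIn {R Q : Type*} [CommRing R] [CommRing Q] [Algebra R Q]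
    (A : Subalgebra R Q) : Submodule R Q :=
  ((Ideal.jacobson (⊥ : Ideal A)).restrictScalars R).map A.val.toLinearMap

/-- The tower `R₀ = R`, `Rᵢ₊₁ = E(Jac Rᵢ)` of rings in `Q`. -/
def jacobsonTower (R Q : Type*) [CommRing R] [CommRing Q] [Algebra R Q] : ℕ → Subalgebra R Q
  | 0 => ⊥
  | i + 1 => multiplierRing (jacobsonRadicalIn (jacobsonTower R Q i))

theorem jacobsonTower_le_succ (R Q : Type*) [CommRing R] [CommRing Q] [Algebra R Q] (i : ℕ) :
    jacobsonTower R Q i ≤ jacobsonTower R Q (i + 1) := by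
  rintro a ha x ⟨y, hy, rfl⟩
  exact ⟨⟨a, ha⟩ * y, Ideal.mul_mem_left _ _ hy, rfl⟩

/-- The ring `R_∞`, the union of the tower; see `coe_jacobsonTowerUnion`. -/
def jacobsonTowerUnion (R Q : Type*) [CommRing R] [CommRing Q] [Algebra R Q] : Subalgebra R Q :=
  ⨆ i : ℕ, jacobsonTower R Q i

theorem coe_jacobsonTowerUnion (R Q : Type*) [CommRing R] [CommRing Q] [Algebra R Q] :
    (jacobsonTowerUnion R Q : Set Q) = ⋃ i : ℕ, (jacobsonTower R Q i : Set Q) :=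
  Subalgebra.coe_iSup_of_directed
    (monotone_nat_of_le_succ (jacobsonTower_le_succ R Q)).directed_le

/-- A quadratic ring: a local ring whose maximal ideal is stable and regular, and for which
`R ⊆ R_∞` is a quadratic extension, where `R_∞` is formed in the total ring of quotients of `R`. -/
def IsQuadraticRing (R : Type*) [CommRing R] : Prop :=
  ∃ _ : IsLocalRing R,
    IsQuadraticExtension R (jacobsonTowerUnion R (FractionRing R)) ∧
    IsStableIdeal (IsLocalRing.maximalIdeal R) ∧
    IsRegularIdeal (IsLocalRing.maximalIdeal R)

/-!
For a nonzerodivisor `s`, an ideal `I` is stable as soon as `s ∈ I · (sI : I²)`, and a regular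
stable ideal satisfies this for some such `s`. Dividing by `s` inside the total ring of quotients
`Q`, the condition says that `I` is invertible over its multiplier ring `E(I)`. For `s = mⁿ`, a
choice which dimension one allows, it can be checked modulo `J`, because `J = mⁿJ`; hence `1 ↔ 5`.

`2 → 3`: Let `R̄` be the integral closure of `R` in `Q`. A finitely generated submodule of `R̄`
containing `1` is stable only if it is a ring, so `R̄` is quadratic over `R`. The module generated
by `1` and `q` is stable for each `q` multiplying a Jacobson radical of the tower into itself, and
dimension one turns this into integrality of `q`; hence `R_∞ ⊆ R̄`. If `R̄` had three maximal
ideals, the residue field of `R` would have two elements, and for `x, y ∈ R̄` with residues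
`(1, 1, 0)` and `(1, 0, 1)` the module `Rx + Ry + Rm` would not be stable.

`3 → 4`: Stability of `M` gives `M R₁ = x R₁`. Since `R_∞` is quadratic over `R`, its Jacobson
radical is then principal, generated by a nonzerodivisor, so `R_∞` is a Dedekind ring. It is thus
integrally closed, and `R_∞ = R̄`.

`4 → 1`: As `R̄` has at most two maximal ideals, `I R̄ = u R̄` for some `u ∈ I`, and quadraticity
gives `I² = u I`.
-/

open IsLocalRing
open scoped nonZeroDivisors

section StableIdeals

variable {R : Type*} [CommRing R] {I : Ideal R} {s : R}

/-- The ideal of all `b` with `b I² ⊆ s I`. For a nonzerodivisor `s`, division by `s` turns its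
elements `b` into the homomorphisms `x ↦ (y ↦ b x y / s)` from `I` to its ring of
endomorphisms. -/
def quadraticColon (s : R) (I : Ideal R) : Ideal R :=
  (Ideal.span {s} * I).colon (I * I : Ideal R)

theorem mem_quadraticColon_iff {b : R} :
    b ∈ quadraticColon s I ↔ ∀ x ∈ I, ∀ y ∈ I, ∃ w ∈ I, b * x * y = s * w := by
  simp only [quadraticColon, Submodule.mem_colon, smul_eq_mul, SetLike.mem_coe,
    Ideal.mem_span_singleton_mul]
  refine ⟨fun h x hx y hy => ?_, fun h t ht => ?_⟩
  · obtain ⟨w, hw, hbw⟩ := h _ (Ideal.mul_mem_mul hx hy)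
    exact ⟨w, hw, by rw [hbw, mul_assoc]⟩
  · induction ht using Submodule.mul_induction_on' with
    | mem_mul_mem x hx y hy =>
      obtain ⟨w, hw, hbw⟩ := h x hx y hy
      exact ⟨w, hw, by rw [← hbw, mul_assoc]⟩
    | add t _ t' _ h h' =>
      obtain ⟨w, hw, hbw⟩ := h
      obtain ⟨w', hw', hbw'⟩ := h'
      exact ⟨w + w', I.add_mem hw hw', by rw [mul_add, mul_add, hbw, hbw']⟩

theorem end_apply_mul_comm (g : Module.End R I) (x y : I) : (g x : R) * y = x * g y := by
  have h : (y : R) • x = (x : R) • y := Subtype.ext (mul_comm _ _)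
  simpa [mul_comm] using congrArg (fun t => (g t : R)) h

theorem dual_apply_mul_comm (φ : I →ₗ[Module.End R I] Module.End R I) (x y z : I) :
    (z : R) * z * φ x y = x * y * φ z z := by
  have h : (algebraMap R (Module.End R I) z) • x = algebraMap R (Module.End R I) x • z :=
    Subtype.ext (mul_comm _ _)
  have hφ : (z : R) * φ x y = x * φ z y := by
    simpa using congrArg (fun g => (g y : R)) ((map_smul φ _ _).symm.trans
      ((congrArg φ h).trans (map_smul φ _ _)))
  linear_combination (z : R) * hφ + (x : R) * end_apply_mul_comm (φ z) y z

theorem IsStableIdeal.exists_mem_mul_quadraticColon (h : IsStableIdeal I)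
    (hI : IsRegularIdeal I) : ∃ s ∈ nonZeroDivisors R, s ∈ I * quadraticColon s I := by
  obtain ⟨z, hz, hz₀⟩ := hI
  obtain ⟨f, hf⟩ := Module.projective_def'.1 h
  lift z to I using hz
  let φ (p : I) : I →ₗ[Module.End R I] Module.End R I := Finsupp.lapply p ∘ₗ f
  have hz_eq : (z : R) = ∑ p ∈ (f z).support, (φ p z p : R) := by
    have hfz : (z : I) = ∑ p ∈ (f z).support, φ p z p := (LinearMap.congr_fun hf z).symm
    simpa using congrArg Subtype.val hfz
  have hzz : (z * z : R) = ∑ p ∈ (f z).support, (p : R) * φ p z z := by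
    conv_lhs => enter [1]; rw [hz_eq]
    rw [Finset.sum_mul]
    exact Finset.sum_congr rfl fun p _ => end_apply_mul_comm (φ p z) p z
  refine ⟨z * z, mul_mem hz₀ hz₀, ?_⟩
  suffices hsum : ∑ p ∈ (f z).support, (p : R) * φ p z z ∈ I * quadraticColon (z * z : R) I by
    rwa [← hzz] at hsum
  refine Ideal.sum_mem _ fun p _ => Ideal.mul_mem_mul p.2 (mem_quadraticColon_iff.2 ?_)
  refine fun x hx y hy => ⟨φ p ⟨x, hx⟩ ⟨y, hy⟩, Subtype.prop _, ?_⟩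
  rw [dual_apply_mul_comm]
  ring

theorem exists_dual_of_mem_quadraticColon (hs : s ∈ nonZeroDivisors R) {b : R}
    (hb : b ∈ quadraticColon s I) :
    ∃ φ : I →ₗ[Module.End R I] Module.End R I, ∀ x y, s * (φ x y : R) = b * x * y := by
  have hcancel {x y : I} (h : s * (x : R) = s * y) : x = y :=
    Subtype.ext ((mul_cancel_left_mem_nonZeroDivisors hs).1 h)
  choose w hw hbw using fun x y : I => mem_quadraticColon_iff.1 hb x x.2 y y.2
  let g (x : I) : Module.End R I :=
    { toFun y := ⟨w x y, hw x y⟩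
      map_add' y y' := hcancel (by simp only [Submodule.coe_add, mul_add, ← hbw])
      map_smul' r y := hcancel (by
        simp only [Submodule.coe_smul, smul_eq_mul, RingHom.id_apply, mul_left_comm s r, ← hbw]
        ring) }
  have hg (x y : I) : s * (g x y : R) = b * x * y := (hbw x y).symm
  refine ⟨⟨⟨g, fun x x' => LinearMap.ext fun y => hcancel ?_⟩,
    fun e x => LinearMap.ext fun y => hcancel ?_⟩, hg⟩
  · simp only [LinearMap.add_apply, Submodule.coe_add, mul_add, add_mul, hg]
  · have hsx : s • g x y = (b * y) • x := Subtype.ext (by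
      simp only [Submodule.coe_smul, smul_eq_mul, hg]; ring)
    have hex : s * (e (g x y) : R) = b * y * e x := by
      simpa using congrArg (fun t => (e t : R)) hsx
    rw [hg]
    change _ = s * (e (g x y) : R)
    rw [hex, Module.End.smul_def]
    ring

theorem isStableIdeal_of_mem_mul_quadraticColon (hs : s ∈ nonZeroDivisors R)
    (h : s ∈ I * quadraticColon s I) : IsStableIdeal I := by
  have key : ∀ t ∈ I * quadraticColon s I, ∃ L : I →ₗ[Module.End R I] (I →₀ Module.End R I),
      ∀ x : I, s * (Finsupp.linearCombination (Module.End R I) id (L x) : I) = t * (x : R) := by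
    intro t ht
    induction ht using Submodule.mul_induction_on' with
    | mem_mul_mem a ha b hb =>
      obtain ⟨φ, hφ⟩ := exists_dual_of_mem_quadraticColon hs hb
      refine ⟨Finsupp.lsingle (⟨a, ha⟩ : I) ∘ₗ φ, fun x => ?_⟩
      have hsingle : Finsupp.linearCombination (Module.End R I) (id : I → I)
          ((Finsupp.lsingle (⟨a, ha⟩ : I) ∘ₗ φ) x) = φ x ⟨a, ha⟩ := by simp
      rw [hsingle, hφ]
      ring
    | add t _ t' _ h h' =>
      obtain ⟨L, hL⟩ := h
      obtain ⟨L', hL'⟩ := h'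
      exact ⟨L + L', fun x => by
        rw [LinearMap.add_apply, map_add, Submodule.coe_add, mul_add, hL, hL', add_mul]⟩
  obtain ⟨L, hL⟩ := key s h
  exact Module.projective_def'.2 ⟨L, LinearMap.ext fun x =>
    Subtype.ext ((mul_cancel_left_mem_nonZeroDivisors hs).1 (hL x))⟩

theorem isStableIdeal_of_mul_eq_mul (hs : s ∈ nonZeroDivisors R) (hsI : s ∈ I)
    (h : ∀ x ∈ I, ∀ y ∈ I, ∃ w ∈ I, x * y = s * w) : IsStableIdeal I := by
  refine isStableIdeal_of_mem_mul_quadraticColon hs ?_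
  have h1 : (1 : R) ∈ quadraticColon s I := mem_quadraticColon_iff.2 (by simpa using h)
  simpa using Ideal.mul_mem_mul hsI h1

end StableIdeals

section StableSubmodules

open scoped Pointwise

variable {R Q : Type*} [CommRing R] [CommRing Q] [Algebra R Q] {V : Submodule R Q}

/-- Stability for an `R`-submodule `V` of `Q`: invertibility of `V` over its multiplier ring
`E(V)`. If `V` contains a unit of `Q` then `V / V²` is the inverse `{q | q V ⊆ E(V)}`. -/
def IsStableSubmodule (V : Submodule R Q) : Prop :=
  (1 : Q) ∈ V * (V / (V * V))

theorem mem_div_mul_self_iff {b : Q} :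
    b ∈ V / (V * V) ↔ ∀ x ∈ V, ∀ y ∈ V, b * (x * y) ∈ V := by
  rw [Submodule.mem_div_iff_forall_mul_mem]
  refine ⟨fun h x hx y hy => h _ (Submodule.mul_mem_mul hx hy), fun h t ht => ?_⟩
  induction ht using Submodule.mul_induction_on' with
  | mem_mul_mem x hx y hy => exact h _ hx _ hy
  | add t _ t' _ h h' => rw [mul_add]; exact V.add_mem h h'

theorem mul_mem_multiplierRing {a b : Q} (ha : a ∈ V) (hb : b ∈ V / (V * V)) :
    a * b ∈ multiplierRing V := fun x hx => by
  rw [mul_right_comm, mul_comm]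
  exact mem_div_mul_self_iff.1 hb a ha x hx

theorem IsStableSubmodule.of_smul {r : R} (hr : IsUnit (algebraMap R Q r))
    (h : IsStableSubmodule (r • V)) : IsStableSubmodule V := by
  rw [IsStableSubmodule] at h ⊢
  refine Submodule.mul_le.2 ?_ h
  rintro _ ⟨v, hv, rfl⟩ b hb
  rw [DistribSMul.toLinearMap_apply, smul_mul_assoc, ← mul_smul_comm]
  refine Submodule.mul_mem_mul hv (mem_div_mul_self_iff.2 fun x hx y hy => ?_)
  obtain ⟨w, hw, hbw⟩ := mem_div_mul_self_iff.1 hb _ (Submodule.smul_mem_pointwise_smul x r V hx) _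
    (Submodule.smul_mem_pointwise_smul y r V hy)
  have hbw' : algebraMap R Q r * w = algebraMap R Q r * (r • b * (x * y)) := by
    simp only [DistribSMul.toLinearMap_apply, Algebra.smul_def] at hbw ⊢
    rw [hbw]; ring
  rwa [← hr.mul_left_cancel hbw']

variable [IsFractionRing R Q]

theorem IsStableIdeal.isStableSubmodule_map {I : Ideal R} (h : IsStableIdeal I)
    (hI : IsRegularIdeal I) : IsStableSubmodule (Submodule.map (Algebra.linearMap R Q) I) := by
  obtain ⟨s, hs, hsI⟩ := h.exists_mem_mul_quadraticColon hI
  obtain ⟨s', hs'⟩ := (IsLocalization.map_units Q ⟨s, hs⟩).exists_left_inv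
  set V := Submodule.map (Algebra.linearMap R Q) I
  have hV {x : R} (hx : x ∈ I) : algebraMap R Q x ∈ V := ⟨x, hx, rfl⟩
  have key : ∀ t ∈ I * quadraticColon s I, s' * algebraMap R Q t ∈ V * (V / (V * V)) := by
    intro t ht
    induction ht using Submodule.mul_induction_on' with
    | mem_mul_mem a ha b hb =>
      rw [map_mul, mul_left_comm]
      refine Submodule.mul_mem_mul (hV ha) (mem_div_mul_self_iff.2 ?_)
      rintro _ ⟨x, hx, rfl⟩ _ ⟨y, hy, rfl⟩
      obtain ⟨w, hw, hbw⟩ := mem_quadraticColon_iff.1 hb x hx y hy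
      convert hV hw using 1
      have hbw' := congrArg (algebraMap R Q) hbw
      simp only [map_mul, Algebra.linearMap_apply] at hbw' ⊢
      linear_combination s' * hbw' + algebraMap R Q w * hs'
    | add t _ t' _ h h' => rw [map_add, mul_add]; exact Submodule.add_mem _ h h'
  simpa [hs', IsStableSubmodule] using key s hsI

theorem IsFinitelyStableRing.isStableSubmodule (h : IsFinitelyStableRing R) (hV : V.FG) {v : Q}
    (hv : v ∈ V) (hvu : IsUnit v) : IsStableSubmodule V := by
  let F : FractionalIdeal (nonZeroDivisors R) Q := ⟨V, FractionalIdeal.isFractional_of_fg hV⟩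
  have hF : F.den • V = Submodule.map (Algebra.linearMap R Q) F.num :=
    FractionalIdeal.den_mul_self_eq_num F
  have hden : IsUnit (algebraMap R Q F.den) := IsLocalization.map_units Q F.den
  have hreg : IsRegularIdeal F.num := by
    have hmem : F.den • v ∈ F.den • V := Submodule.smul_mem_pointwise_smul v F.den V hv
    obtain ⟨x, hx, hxv⟩ := hF ▸ hmem
    refine ⟨x, hx, mem_nonZeroDivisors_of_injective (IsFractionRing.injective R Q) ?_⟩
    rw [← Algebra.linearMap_apply, hxv, Submonoid.smul_def, Algebra.smul_def]
    exact (hden.mul hvu).mem_nonZeroDivisors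
  have hfg : F.num.FG := Submodule.fg_of_fg_map_injective (Algebra.linearMap R Q)
    (IsFractionRing.injective R Q) (hF ▸ hV.map _)
  exact IsStableSubmodule.of_smul hden (hF ▸ (h _ hfg hreg).isStableSubmodule_map hreg)

end StableSubmodules

section MultiplierRing

variable {R Q : Type*} [CommRing R] [CommRing Q] [Algebra R Q] {V : Submodule R Q}

theorem isIntegral_of_mem_multiplierRing (hV : V.FG) {v : Q} (hv : v ∈ V) (hvu : IsUnit v)
    {e : Q} (he : e ∈ multiplierRing V) : IsIntegral R e := by
  have := Module.Finite.iff_fg.2 hV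
  let f : multiplierRing V →ₐ[R] Module.End R V :=
    { toFun e := (LinearMap.mulLeft R (e : Q)).restrict e.2
      map_one' := LinearMap.ext fun x => Subtype.ext (one_mul _)
      map_mul' e e' := LinearMap.ext fun x => Subtype.ext (mul_assoc _ _ _)
      map_zero' := LinearMap.ext fun x => Subtype.ext (zero_mul _)
      map_add' e e' := LinearMap.ext fun x => Subtype.ext (add_mul _ _ _)
      commutes' r := LinearMap.ext fun x => Subtype.ext (Algebra.smul_def _ _).symm }
  have hf : Function.Injective f := fun e e' hee => Subtype.ext (hvu.mul_right_cancel
    (congrArg Subtype.val (LinearMap.congr_fun hee ⟨v, hv⟩)))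
  have hint : IsIntegral R (f ⟨e, he⟩) := Algebra.IsIntegral.isIntegral _
  rw [isIntegral_algHom_iff (A := multiplierRing V) (B := Module.End R V) f hf] at hint
  exact hint.map (multiplierRing V).val

end MultiplierRing

section MaximalIdeals

variable {A B : Type*} [CommRing A] [CommRing B]

theorem HasAtMostTwoMaximalIdeals.exists_pair [Nontrivial A] (h : HasAtMostTwoMaximalIdeals A) :
    ∃ N₁ N₂ : Ideal A, N₁.IsMaximal ∧ N₂.IsMaximal ∧
      ∀ N : Ideal A, N.IsMaximal → N = N₁ ∨ N = N₂ := by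
  obtain ⟨N₁, h₁⟩ := Ideal.exists_maximal A
  by_cases! h' : ∃ N₂ : Ideal A, N₂.IsMaximal ∧ N₂ ≠ N₁
  · obtain ⟨N₂, h₂, h₂₁⟩ := h'
    refine ⟨N₁, N₂, h₁, h₂, fun N hN => ?_⟩
    by_contra! hc
    have hsub : ({N, N₁, N₂} : Set (Ideal A)) ⊆ {N | N.IsMaximal} := by
      rintro x (rfl | rfl | rfl) <;> assumption
    have hcard := (Set.encard_le_encard hsub).trans h
    rw [Set.encard_eq_three.2 ⟨N, N₁, N₂, hc.1, hc.2, h₂₁.symm, rfl⟩] at hcard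
    exact absurd hcard (by decide)
  · exact ⟨N₁, N₁, h₁, h₁, fun N hN => Or.inl (h' N hN)⟩

theorem exists_injective_of_not_hasAtMostTwoMaximalIdeals (h : ¬ HasAtMostTwoMaximalIdeals A) :
    ∃ N : Fin 3 → Ideal A, Function.Injective N ∧ ∀ i, (N i).IsMaximal := by
  have hcard : (3 : ℕ∞) ≤ {N : Ideal A | N.IsMaximal}.encard := Order.add_one_le_of_lt (not_le.1 h)
  obtain ⟨t, ht, ht'⟩ := Set.exists_subset_encard_eq hcard
  obtain ⟨x, y, z, hxy, hxz, hyz, rfl⟩ := Set.encard_eq_three.1 ht'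
  refine ⟨![x, y, z], ?_, ?_⟩
  · intro i j hij
    fin_cases i <;> fin_cases j <;> simp_all [eq_comm]
  · intro i
    fin_cases i <;> exact ht (by simp)

theorem HasAtMostTwoMaximalIdeals.finite_maximalSpectrum (h : HasAtMostTwoMaximalIdeals A) :
    Finite (MaximalSpectrum A) :=
  have hfin : {N : Ideal A | N.IsMaximal}.Finite :=
    Set.encard_lt_top_iff.1 (lt_of_le_of_lt h (by decide))
  have : Finite {N : Ideal A // N.IsMaximal} := hfin.to_subtype
  Finite.of_equiv _ (MaximalSpectrum.equivSubtype A).symm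

theorem mem_jacobson_bot_iff_forall_isMaximal {x : A} :
    x ∈ Ideal.jacobson (⊥ : Ideal A) ↔ ∀ N : Ideal A, N.IsMaximal → x ∈ N := by
  simp [Ideal.jacobson_bot, Ring.jacobson_eq_sInf_isMaximal, Submodule.mem_sInf]

theorem exists_isMaximal_comap_eq {f : A →+* B} (hf : f.IsIntegral)
    (hinj : Function.Injective f) {N : Ideal A} (hN : N.IsMaximal) :
    ∃ P : Ideal B, P.IsMaximal ∧ P.comap f = N := by
  algebraize [f]
  refine Ideal.exists_ideal_over_maximal_of_isIntegral (S := B) N ?_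
  rw [(RingHom.injective_iff_ker_eq_bot (algebraMap A B)).1 hinj]
  exact bot_le

theorem HasAtMostTwoMaximalIdeals.of_isIntegral {f : A →+* B} (hf : f.IsIntegral)
    (hinj : Function.Injective f) (h : HasAtMostTwoMaximalIdeals B) :
    HasAtMostTwoMaximalIdeals A :=
  ((Set.encard_le_encard fun _ hN => exists_isMaximal_comap_eq hf hinj hN).trans
    (Set.encard_image_le (Ideal.comap f) _)).trans h

theorem map_mem_jacobson_bot_iff {f : A →+* B} (hf : f.IsIntegral)
    (hinj : Function.Injective f) {x : A} :
    f x ∈ Ideal.jacobson (⊥ : Ideal B) ↔ x ∈ Ideal.jacobson (⊥ : Ideal A) := by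
  simp only [mem_jacobson_bot_iff_forall_isMaximal]
  refine ⟨fun hx N hN => ?_, fun hx P hP => ?_⟩
  · obtain ⟨P, hP, rfl⟩ := exists_isMaximal_comap_eq hf hinj hN
    exact hx P hP
  · exact hx _ (Ideal.isMaximal_comap_of_isIntegral_of_isMaximal' f hf P)

theorem algebraMap_mem_iff_of_isMaximal [IsLocalRing A] [Algebra A B] [Algebra.IsIntegral A B]
    {N : Ideal B} (hN : N.IsMaximal) {a : A} : algebraMap A B a ∈ N ↔ a ∈ maximalIdeal A := by
  rw [← eq_maximalIdeal (Ideal.isMaximal_comap_of_isIntegral_of_isMaximal (R := A) N),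
    Ideal.mem_comap]

theorem krullDimLE_one_of_isIntegral [Ring.KrullDimLE 1 A] [Algebra A B]
    [Algebra.IsIntegral A B] : Ring.KrullDimLE 1 B := by
  refine .mk₁ fun P hP => or_iff_not_imp_right.2 fun hmax => ?_
  refine ⟨⟨hP, bot_le⟩, fun P' ⟨hP', _⟩ hle => ?_⟩
  by_contra hlt
  have hcomap := Ideal.IsIntegral.comap_lt_comap (R := A) (lt_of_le_not_ge hle hlt)
  rcases Ring.krullDimLE_one_iff.1 ‹_› (P.comap (algebraMap A B)) inferInstance with h | h
  · exact hcomap.not_ge (h.2 ⟨hP'.comap _, bot_le⟩ hcomap.le)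
  · exact hmax (Ideal.isMaximal_of_isIntegral_of_isMaximal_comap P h)

theorem exists_dvd_pow_mul_one_sub [Ring.KrullDimLE 1 A] {s : A} (hs : s ∈ nonZeroDivisors A)
    (d : A) : ∃ (n : ℕ) (y : A), s ∣ d ^ n * (1 - d * y) := by
  let S : Submonoid A :=
    { carrier := {a | ∃ (n : ℕ) (y : A), a = d ^ n * (1 - d * y)}
      one_mem' := ⟨0, 0, by simp⟩
      mul_mem' := by
        rintro _ _ ⟨n, y, rfl⟩ ⟨k, z, rfl⟩
        exact ⟨n + k, y + z - d * y * z, by ring⟩ }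
  by_contra! hdvd
  have hdisj : Disjoint (Ideal.span {s} : Set A) S := Set.disjoint_left.2 fun a ha ⟨n, y, hay⟩ =>
    hdvd n y (hay ▸ Ideal.mem_span_singleton.1 ha)
  obtain ⟨P, hP, hsP, hPS⟩ := Ideal.exists_le_prime_disjoint _ S hdisj
  replace hsP : s ∈ P := hsP (Ideal.mem_span_singleton_self s)
  have hmax : P.IsMaximal := (Ring.krullDimLE_one_iff.1 ‹_› P hP).resolve_left fun hmin =>
    Set.disjoint_left.1 (Ideal.disjoint_nonZeroDivisors_of_mem_minimalPrimes hmin) hsP hs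
  have hd : d ∉ P := fun hd => Set.disjoint_left.1 hPS hd ⟨1, 0, by simp⟩
  obtain ⟨y, z, hz, hyz⟩ := hmax.exists_inv hd
  exact Set.disjoint_left.1 hPS hz ⟨0, y, by linear_combination hyz⟩

theorem exists_dvd_pow_of_mem_jacobson_bot [Ring.KrullDimLE 1 A] {s : A}
    (hs : s ∈ nonZeroDivisors A) {d : A} (hd : d ∈ Ideal.jacobson (⊥ : Ideal A)) :
    ∃ n : ℕ, s ∣ d ^ n := by
  obtain ⟨n, y, h⟩ := exists_dvd_pow_mul_one_sub hs d
  have hu : IsUnit (1 - d * y) := by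
    convert Ideal.mem_jacobson_bot.1 hd (-y) using 1
    ring
  exact ⟨n, (hu.dvd_mul_right).1 h⟩

end MaximalIdeals

section Subalgebras

variable {R Q : Type*} [CommRing R] [CommRing Q] [Algebra R Q]

theorem inclusion_isIntegral {A B : Subalgebra R Q} [Algebra.IsIntegral R B] (h : A ≤ B) :
    (Subalgebra.inclusion h).toRingHom.IsIntegral :=
  RingHom.IsIntegral.tower_top (algebraMap R A) _ (Algebra.IsIntegral.isIntegral (A := B))

-- The additive group of `V` is not the union of the two proper subgroups `{v | v C ⊆ Nᵢ}`.
theorem HasAtMostTwoMaximalIdeals.exists_mul_eq_one [Nontrivial Q] {A : Subalgebra R Q}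
    (h : HasAtMostTwoMaximalIdeals A) {V C : Submodule R Q}
    (hAC : A.toSubmodule * C ≤ C) (hVC : V * C ≤ A.toSubmodule) (h1 : (1 : Q) ∈ V * C) :
    ∃ v ∈ V, ∃ c ∈ C, v * c = 1 := by
  obtain ⟨N₁, N₂, h₁, h₂, hN⟩ := h.exists_pair
  let inQ (N : Ideal A) : Submodule R Q := (N.restrictScalars R).map A.val.toLinearMap
  have hproper {N : Ideal A} (hN : N.IsMaximal) : ¬ V ≤ inQ N / C := fun hle => by
    obtain ⟨a, ha, ha1⟩ := Submodule.le_div_iff_mul_le.1 hle h1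
    exact hN.ne_top ((Ideal.eq_top_iff_one N).2 ((Subtype.ext ha1 : a = 1) ▸ ha))
  obtain ⟨v, hv, hvN⟩ := Set.not_subset.1 fun hsub =>
    (AddSubgroupClass.subset_union.1 hsub).elim (hproper h₁) (hproper h₂)
  let I : Ideal A :=
    { carrier := {a | ∃ c ∈ C, v * c = a}
      zero_mem' := ⟨0, C.zero_mem, mul_zero v⟩
      add_mem' := by
        rintro a b ⟨c, hc, hca⟩ ⟨d, hd, hdb⟩
        exact ⟨c + d, C.add_mem hc hd, by rw [mul_add, hca, hdb]; rfl⟩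
      smul_mem' := by
        rintro a b ⟨c, hc, hcb⟩
        exact ⟨a * c, hAC (Submodule.mul_mem_mul a.2 hc), by rw [mul_left_comm, hcb]; rfl⟩ }
  have hI {N : Ideal A} (hIN : I ≤ N) : v ∈ inQ N / C :=
    Submodule.mem_div_iff_forall_mul_mem.2 fun c hc =>
      ⟨⟨v * c, hVC (Submodule.mul_mem_mul hv hc)⟩, hIN ⟨c, hc, rfl⟩, rfl⟩
  have hItop : I = ⊤ := by
    by_contra hne
    obtain ⟨N, hNmax, hIN⟩ := Ideal.exists_le_maximal I hne
    rcases hN N hNmax with rfl | rfl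
    exacts [hvN (Or.inl (hI hIN)), hvN (Or.inr (hI hIN))]
  obtain ⟨c, hc, hvc⟩ := (Ideal.eq_top_iff_one I).1 hItop
  exact ⟨v, hv, c, hc, hvc⟩

theorem HasAtMostTwoMaximalIdeals.exists_map_eq_span [Nontrivial Q] {A : Subalgebra R Q}
    (h : HasAtMostTwoMaximalIdeals A) {I : Ideal R} {C : Submodule R Q}
    (hAC : A.toSubmodule * C ≤ C)
    (hIC : Submodule.map (Algebra.linearMap R Q) I * C ≤ A.toSubmodule)
    (h1 : (1 : Q) ∈ Submodule.map (Algebra.linearMap R Q) I * C) :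
    ∃ u ∈ I, IsUnit (algebraMap R Q u) ∧
      I.map (algebraMap R A) = Ideal.span {algebraMap R A u} := by
  obtain ⟨_, ⟨u, hu, rfl⟩, c, hc, huc⟩ := h.exists_mul_eq_one hAC hIC h1
  replace huc : algebraMap R Q u * c = 1 := huc
  refine ⟨u, hu, IsUnit.of_mul_eq_one c huc, le_antisymm
    (Ideal.map_le_iff_le_comap.2 fun x hx => Ideal.mem_span_singleton.2 ?_)
    ((Ideal.span_singleton_le_iff_mem _).2 (Ideal.mem_map_of_mem _ hu))⟩
  refine ⟨⟨_, hIC (Submodule.mul_mem_mul (Submodule.mem_map_of_mem hx) hc)⟩, Subtype.ext ?_⟩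
  change algebraMap R Q x = algebraMap R Q u * (algebraMap R Q x * c)
  rw [mul_left_comm, huc, mul_one]

end Subalgebras

section Quadratic

variable {R S T : Type*} [CommRing R] [CommRing S] [CommRing T] [Algebra R S] [Algebra R T]

theorem IsQuadraticExtension.isIntegral (h : IsQuadraticExtension R S) :
    Algebra.IsIntegral R S := by
  refine ⟨fun x => ?_⟩
  obtain ⟨a, b, c, hx⟩ := h x x
  refine ⟨.X ^ 2 - .C (a + b) * .X - .C c, by monicity!, ?_⟩
  simp only [Algebra.smul_def] at hx
  simp only [Polynomial.eval₂_sub, Polynomial.eval₂_mul, Polynomial.eval₂_pow, Polynomial.eval₂_X,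
    Polynomial.eval₂_C, Polynomial.eval₂_add, map_add]
  linear_combination hx

theorem IsQuadraticExtension.of_injective (h : IsQuadraticExtension R T) (f : S →ₐ[R] T)
    (hf : Function.Injective f) : IsQuadraticExtension R S := fun x y => by
  obtain ⟨a, b, c, hxy⟩ := h (f x) (f y)
  exact ⟨a, b, c, hf (by simpa using hxy)⟩

end Quadratic

section FinitelyStable

variable {R Q : Type*} [CommRing R] [CommRing Q] [Algebra R Q] {V : Submodule R Q}

theorem IsStableSubmodule.mul_self_le (h : IsStableSubmodule V) (h1 : 1 ∈ V)
    (hV : V ≤ (integralClosure R Q).toSubmodule) : V * V ≤ V := by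
  have hEV {e : Q} (he : e ∈ multiplierRing V) : e ∈ V := by simpa using he 1 h1
  let I : Ideal (multiplierRing V) :=
    { carrier := {e | (e : Q) ∈ V / (V * V)}
      zero_mem' := (V / (V * V)).zero_mem
      add_mem' := (V / (V * V)).add_mem
      smul_mem' := fun e c hc => mem_div_mul_self_iff.2 fun x hx y hy => by
        rw [smul_eq_mul, Subalgebra.coe_mul, mul_assoc]
        exact e.2 _ (mem_div_mul_self_iff.1 hc x hx y hy) }
  suffices hI : I = ⊤ by
    have hmem : (1 : Q) ∈ V / (V * V) := (Ideal.eq_top_iff_one I).1 hI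
    exact fun t ht => by simpa using Submodule.mem_div_iff_forall_mul_mem.1 hmem t ht
  by_contra hI
  obtain ⟨N, hN, hIN⟩ := Ideal.exists_le_maximal I hI
  have hle : multiplierRing V ≤ integralClosure R Q := fun e he => hV (hEV he)
  obtain ⟨P, hP, rfl⟩ := exists_isMaximal_comap_eq (inclusion_isIntegral hle)
    (Subalgebra.inclusion_injective hle) hN
  let inQ : Submodule R Q := (P.restrictScalars R).map (integralClosure R Q).val.toLinearMap
  have hVP : V * (V / (V * V)) ≤ inQ := Submodule.mul_le.2 fun v hv c hc => by
    have hcE : c ∈ multiplierRing V := by simpa using mul_mem_multiplierRing h1 hc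
    have hcP : Subalgebra.inclusion hle ⟨c, hcE⟩ ∈ P := hIN (show ⟨c, hcE⟩ ∈ I from hc)
    exact ⟨⟨v, hV hv⟩ * Subalgebra.inclusion hle ⟨c, hcE⟩, P.mul_mem_left _ hcP, rfl⟩
  obtain ⟨p, hp, hp1⟩ := hVP h
  exact hP.ne_top ((Ideal.eq_top_iff_one P).2 ((Subtype.ext hp1 : p = 1) ▸ hp))

theorem IsFinitelyStableRing.isQuadraticExtension_integralClosure [IsFractionRing R Q]
    (h : IsFinitelyStableRing R) : IsQuadraticExtension R (integralClosure R Q) := by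
  intro x y
  let V : Submodule R Q := Submodule.span R {(x : Q), (y : Q), 1}
  have h1 : (1 : Q) ∈ V := Submodule.subset_span (by simp)
  have hV : V ≤ (integralClosure R Q).toSubmodule := by
    refine Submodule.span_le.2 ?_
    rintro _ (rfl | rfl | rfl)
    exacts [x.2, y.2, (integralClosure R Q).one_mem]
  have hVV := (h.isStableSubmodule (Submodule.fg_span (by simp)) h1 isUnit_one).mul_self_le h1 hV
  have hxy : (x * y : Q) ∈ V :=
    hVV (Submodule.mul_mem_mul (Submodule.subset_span (by simp)) (Submodule.subset_span (by simp)))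
  obtain ⟨a, b, c, habc⟩ := Submodule.mem_span_triple.1 hxy
  exact ⟨a, b, c, Subtype.ext (by simp [← habc, Algebra.algebraMap_eq_smul_one])⟩

theorem IsQuadraticExtension.mem_or_sub_one_mem {S : Type*} [CommRing S] [Algebra R S]
    [IsLocalRing R] (h : IsQuadraticExtension R S) {N : Fin 3 → Ideal S}
    (hN : ∀ i, (N i).IsMaximal) (hinj : Function.Injective N) (t : R) :
    t ∈ maximalIdeal R ∨ t - 1 ∈ maximalIdeal R := by
  have := h.isIntegral
  let r : Fin 3 → R := ![1, t, 0]
  obtain ⟨x, hx⟩ := Ideal.pi_quotient_surjective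
    (fun i j hij => Ideal.isCoprime_of_isMaximal (hinj.ne hij))
    fun i => Ideal.Quotient.mk (N i) (algebraMap R S (r i))
  obtain ⟨a, b, c, habc⟩ := h x x
  have hr (i : Fin 3) : r i * r i - (a + b) * r i - c ∈ maximalIdeal R := by
    rw [← algebraMap_mem_iff_of_isMaximal (hN i), ← Ideal.Quotient.eq_zero_iff_mem]
    have hxx := congrArg (Ideal.Quotient.mk (N i)) habc
    simp only [Algebra.smul_def, map_add, map_sub, map_mul, hx] at hxx ⊢
    linear_combination hxx
  rw [← (maximalIdeal.isMaximal R).isPrime.mul_mem_iff_mem_or_mem]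
  have h0 : 1 * 1 - (a + b) * 1 - c ∈ maximalIdeal R := hr 0
  have h1 : t * t - (a + b) * t - c ∈ maximalIdeal R := hr 1
  have h2 : 0 * 0 - (a + b) * 0 - c ∈ maximalIdeal R := hr 2
  convert Ideal.sub_mem _ h1 (Ideal.add_mem _ (Ideal.mul_mem_left _ t h0)
    (Ideal.mul_mem_left _ (1 - t) h2)) using 1
  ring

theorem IsStableSubmodule.map_eq_map_of_ne_zero {A : Subalgebra R Q} {F : Type*} [CommRing F]
    [Nontrivial F] (hV : IsStableSubmodule V) (hVA : V ≤ A.toSubmodule)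
    (hEA : multiplierRing V ≤ A) (π : A →+* F)
    (hπ : ∀ e : A, (e : Q) ∈ multiplierRing V → π e = 0 ∨ π e = 1) {x y : A} (hx : (x : Q) ∈ V)
    (hy : (y : Q) ∈ V) (hx0 : π x ≠ 0) (hy0 : π y ≠ 0) : π x = π y := by
  by_contra hxy
  have hker : V * (V / (V * V)) ≤
      ((RingHom.ker π).restrictScalars R).map A.val.toLinearMap := by
    refine Submodule.mul_le.2 fun a ha b hb => ?_
    have hE {v : Q} (hv : v ∈ V) : v * b ∈ multiplierRing V := mul_mem_multiplierRing hv hb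
    let bit {v : Q} (hv : v ∈ V) : A := ⟨v * b, hEA (hE hv)⟩
    refine ⟨bit ha, (hπ (bit ha) (hE ha)).resolve_right fun hone => hxy ?_, rfl⟩
    have hmap {v : A} (hv : (v : Q) ∈ V) (hv0 : π v ≠ 0) : π v = π ⟨a, hVA ha⟩ := by
      have hva : v * bit ha = ⟨a, hVA ha⟩ * bit hv := Subtype.ext (mul_left_comm _ _ _)
      have hπva : π v = π ⟨a, hVA ha⟩ * π (bit hv) := by
        rw [← map_mul, ← hva, map_mul, hone, mul_one]
      rcases hπ (bit hv) (hE hv) with h | h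
      · exact absurd (by rw [hπva, h, mul_zero]) hv0
      · rw [hπva, h, mul_one]
    rw [hmap hx hx0, hmap hy hy0]
  obtain ⟨e, he, he1⟩ := hker hV
  exact one_ne_zero (map_one π ▸ (Subtype.ext he1 : e = 1) ▸ he : (1 : F) = 0)

theorem eq_zero_or_one_of_mul_one_sub_single {F : Fin 3 → Type*} [∀ i, CommRing (F i)]
    [∀ i, Nontrivial (F i)] {u x y : ∀ i, F i} (hx : x = 1 - Pi.single 2 1)
    (hy : y = 1 - Pi.single 1 1) (hux : u * x ∈ ({0, x, y, x + y} : Set (∀ i, F i)))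
    (huy : u * y ∈ ({0, x, y, x + y} : Set (∀ i, F i))) : u = 0 ∨ u = 1 := by
  have hx2 : u * x = 0 ∨ u * x = x := by
    rcases hux with h | h | h | h
    · exact .inl h
    · exact .inr h
    all_goals exact absurd (congrFun h 2) (by simp [hx, hy])
  have hy1 : u * y = 0 ∨ u * y = y := by
    rcases huy with h | h | h | h
    · exact .inl h
    · exact absurd (congrFun h 1) (by simp [hx, hy])
    · exact .inr h
    · exact absurd (congrFun h 1) (by simp [hx, hy])
  have h01 : u 0 = 0 ∧ u 1 = 0 ∨ u 0 = 1 ∧ u 1 = 1 := hx2.imp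
    (fun h => ⟨by simpa [hx] using congrFun h 0, by simpa [hx] using congrFun h 1⟩)
    fun h => ⟨by simpa [hx] using congrFun h 0, by simpa [hx] using congrFun h 1⟩
  have h02 : u 0 = 0 ∧ u 2 = 0 ∨ u 0 = 1 ∧ u 2 = 1 := hy1.imp
    (fun h => ⟨by simpa [hy] using congrFun h 0, by simpa [hy] using congrFun h 2⟩)
    fun h => ⟨by simpa [hy] using congrFun h 0, by simpa [hy] using congrFun h 2⟩
  simp only [funext_iff, Fin.forall_fin_succ, Fin.forall_fin_zero, Pi.zero_apply, Pi.one_apply]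
  rcases h01 with ⟨h0, h1⟩ | ⟨h0, h1⟩ <;> rcases h02 with ⟨h0', h2⟩ | ⟨h0', h2⟩
  · exact .inl ⟨h0, h1, h2, trivial⟩
  · exact absurd (h0.symm.trans h0') zero_ne_one
  · exact absurd (h0'.symm.trans h0) zero_ne_one
  · exact .inr ⟨h0, h1, h2, trivial⟩

theorem map_mem_of_mem_span_triple {A : Subalgebra R Q} {F : Type*} [CommRing F] (π : A →+* F)
    (hπ : ∀ r : R, π (algebraMap R A r) = 0 ∨ π (algebraMap R A r) = 1) {x y z v : A}
    (hz : π z = 0) (hv : (v : Q) ∈ Submodule.span R {(x : Q), (y : Q), (z : Q)}) :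
    π v ∈ ({0, π x, π y, π x + π y} : Set F) := by
  obtain ⟨a, b, c, hv⟩ := Submodule.mem_span_triple.1 hv
  obtain rfl : algebraMap R A a * x + algebraMap R A b * y + algebraMap R A c * z = v :=
    Subtype.ext (by simp [← hv, Algebra.smul_def])
  rcases hπ a with ha | ha <;> rcases hπ b with hb | hb <;> simp [ha, hb, hz]

theorem IsFinitelyStableRing.hasAtMostTwoMaximalIdeals [IsFractionRing R Q] [IsLocalRing R]
    (h : IsFinitelyStableRing R) {m : R} (hm : m ∈ maximalIdeal R) (hreg : m ∈ nonZeroDivisors R) :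
    HasAtMostTwoMaximalIdeals (integralClosure R Q) := by
  by_contra hcard
  obtain ⟨N, hinj, hN⟩ := exists_injective_of_not_hasAtMostTwoMaximalIdeals hcard
  have (i : Fin 3) : Nontrivial (integralClosure R Q ⧸ N i) :=
    Ideal.Quotient.nontrivial_iff.2 (hN i).ne_top
  let π : integralClosure R Q →+* ∀ i, integralClosure R Q ⧸ N i :=
    RingHom.pi fun i => Ideal.Quotient.mk (N i)
  have hπ : Function.Surjective π := fun u =>
    (Ideal.pi_quotient_surjective
      (fun i j hij => Ideal.isCoprime_of_isMaximal (hinj.ne hij)) u).imp fun _ => funext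
  have hπm {r : R} (hr : r ∈ maximalIdeal R) : π (algebraMap R _ r) = 0 := funext fun i =>
    Ideal.Quotient.eq_zero_iff_mem.2 ((algebraMap_mem_iff_of_isMaximal (hN i)).2 hr)
  have hπR (r : R) : π (algebraMap R _ r) = 0 ∨ π (algebraMap R _ r) = 1 := by
    have hQ := h.isQuadraticExtension_integralClosure (Q := Q)
    refine (hQ.mem_or_sub_one_mem hN hinj r).imp hπm fun hr => ?_
    simpa [sub_eq_zero] using hπm hr
  have hπm0 := hπm hm
  obtain ⟨x, hx⟩ := hπ (1 - Pi.single 2 1)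
  obtain ⟨y, hy⟩ := hπ (1 - Pi.single 1 1)
  let V : Submodule R Q := Submodule.span R {(x : Q), (y : Q), algebraMap R Q m}
  have hxV : (x : Q) ∈ V := Submodule.subset_span (by simp)
  have hyV : (y : Q) ∈ V := Submodule.subset_span (by simp)
  have hmV : algebraMap R Q m ∈ V := Submodule.subset_span (by simp)
  have hmu : IsUnit (algebraMap R Q m) := IsLocalization.map_units Q ⟨m, hreg⟩
  have hfg : V.FG := Submodule.fg_span (by simp)
  have hEA {e : Q} (he : e ∈ multiplierRing V) : IsIntegral R e :=
    isIntegral_of_mem_multiplierRing hfg hmV hmu he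
  have hπE (e : integralClosure R Q) (he : (e : Q) ∈ multiplierRing V) : π e = 0 ∨ π e = 1 := by
    refine eq_zero_or_one_of_mul_one_sub_single hx hy (map_mul π e x ▸ ?_) (map_mul π e y ▸ ?_)
    exacts [map_mem_of_mem_span_triple π hπR hπm0 (he _ hxV),
      map_mem_of_mem_span_triple π hπR hπm0 (he _ hyV)]
  have hVA : V ≤ (integralClosure R Q).toSubmodule := by
    refine Submodule.span_le.2 ?_
    rintro _ (rfl | rfl | rfl)
    exacts [x.2, y.2, (integralClosure R Q).algebraMap_mem m]
  have hxy := (h.isStableSubmodule hfg hmV hmu).map_eq_map_of_ne_zero hVA (fun _ => hEA) π hπE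
    hxV hyV (fun h => by simpa [hx] using congrFun h 0) fun h => by simpa [hy] using congrFun h 0
  simpa [hx, hy] using congrFun hxy 1

end FinitelyStable

section Tower

variable {R Q : Type*} [CommRing R] [CommRing Q] [Algebra R Q]

theorem mem_span_one_pair_mul {C : Submodule R Q} {q x : Q} :
    x ∈ Submodule.span R {1, q} * C ↔ ∃ c ∈ C, ∃ d ∈ C, c + q * d = x := by
  simp [Submodule.span_insert, Submodule.sup_mul, Submodule.mem_sup,
    Submodule.mem_span_singleton_mul]

theorem mem_of_add_mul_eq_one {A : Subalgebra R Q} [Ring.KrullDimLE 1 A] {q : Q}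
    {m c d : A} (hm : m ∈ nonZeroDivisors A) (hqm : ∀ n : ℕ, q ^ n * m ∈ A) (hqc : q * c ∈ A)
    (hqd : q * d ∈ A) (hcd : c + q * d = 1) : q ∈ A := by
  let D : Ideal A :=
    { carrier := {t | q * t ∈ A}
      zero_mem' := by simp
      add_mem' := fun {a b} ha hb => by simpa [mul_add] using A.add_mem ha hb
      smul_mem' := fun a b hb => by simpa [mul_left_comm q] using A.mul_mem a.2 hb }
  obtain ⟨n, y, s, hs⟩ := exists_dvd_pow_mul_one_sub hm d
  let u : A := ⟨q * d, hqd⟩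
  have htu : (1 - d * y) * u ^ n ∈ D := by
    change q * ((1 - d * y : A) * (q * d) ^ n : Q) ∈ A
    convert A.mul_mem (hqm (n + 1)) s.2 using 1
    have hs' := congrArg Subtype.val hs
    push_cast at hs' ⊢
    linear_combination q ^ (n + 1) * hs'
  have hmk {t : A} (ht : t ∈ D) : Ideal.Quotient.mk D t = 0 := Ideal.Quotient.eq_zero_iff_mem.2 ht
  have hu : Ideal.Quotient.mk D u = 1 := by
    have huc : u = 1 - c := Subtype.ext (eq_sub_of_add_eq' hcd)
    rw [huc, map_sub, map_one, hmk hqc, sub_zero]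
  have h1 : (1 : A) ∈ D := by
    rw [← Ideal.Quotient.eq_zero_iff_mem, ← hmk htu]
    simp only [map_mul, map_sub, map_one, map_pow, hu, hmk hqd, zero_mul, sub_zero, one_pow,
      mul_one]
  simpa using show q * ((1 : A) : Q) ∈ A from h1

variable [IsFractionRing R Q] [Ring.KrullDimLE 1 R] {m : R}

theorem IsFinitelyStableRing.isIntegral_of_mul_mem (h : IsFinitelyStableRing R)
    (hreg : m ∈ nonZeroDivisors R) {W : Submodule R Q}
    (hW : W ≤ (integralClosure R Q).toSubmodule) (hmW : algebraMap R Q m ∈ W) {q : Q}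
    (hq : q ∈ multiplierRing W) : IsIntegral R q := by
  let V : Submodule R Q := Submodule.span R {1, q}
  have h1 : (1 : Q) ∈ V := Submodule.subset_span (by simp)
  have hqV : q ∈ V := Submodule.subset_span (by simp)
  have hfg : V.FG := Submodule.fg_span (by simp)
  obtain ⟨c, hc, d, hd, hcd⟩ := mem_span_one_pair_mul.1 (h.isStableSubmodule hfg h1 isUnit_one)
  have hVC {v b : Q} (hv : v ∈ V) (hb : b ∈ V / (V * V)) : v * b ∈ integralClosure R Q :=
    isIntegral_of_mem_multiplierRing hfg h1 isUnit_one (mul_mem_multiplierRing hv hb)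
  have hE {b : Q} (hb : b ∈ V / (V * V)) : b ∈ integralClosure R Q := one_mul b ▸ hVC h1 hb
  have := krullDimLE_one_of_isIntegral (A := R) (B := integralClosure R Q)
  have hreg' : algebraMap R (integralClosure R Q) m ∈ nonZeroDivisors _ :=
    mem_nonZeroDivisors_of_injective (f := (integralClosure R Q).val) Subtype.val_injective
      (IsLocalization.map_units Q ⟨m, hreg⟩).mem_nonZeroDivisors
  exact mem_of_add_mul_eq_one (c := ⟨c, hE hc⟩) (d := ⟨d, hE hd⟩) hreg'
    (fun n => hW (pow_mem hq n _ hmW)) (hVC hqV hc) (hVC hqV hd) hcd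

variable [IsLocalRing R]

theorem IsFinitelyStableRing.jacobsonTower_le (h : IsFinitelyStableRing R)
    (hm : m ∈ maximalIdeal R) (hreg : m ∈ nonZeroDivisors R) (i : ℕ) :
    jacobsonTower R Q i ≤ integralClosure R Q := by
  induction i with
  | zero => exact bot_le
  | succ i ih =>
    have := le_integralClosure_iff_isIntegral.1 ih
    refine fun q =>
      h.isIntegral_of_mul_mem hreg (W := jacobsonRadicalIn (jacobsonTower R Q i)) ?_ ?_
    · rintro _ ⟨a, -, rfl⟩
      exact ih a.2
    · exact ⟨algebraMap R _ m, mem_jacobson_bot_iff_forall_isMaximal.2 fun N hN =>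
        (algebraMap_mem_iff_of_isMaximal hN).2 hm, rfl⟩

theorem IsFinitelyStableRing.isQuadraticExtension_jacobsonTowerUnion
    (h : IsFinitelyStableRing R) (hm : m ∈ maximalIdeal R) (hreg : m ∈ nonZeroDivisors R) :
    IsQuadraticExtension R (jacobsonTowerUnion R Q) :=
  h.isQuadraticExtension_integralClosure.of_injective
    (Subalgebra.inclusion (iSup_le (h.jacobsonTower_le hm hreg)))
    (Subalgebra.inclusion_injective _)

end Tower

section JacobsonRadical

variable {R S : Type*} [CommRing R] [CommRing S] [Algebra R S]

theorem isUnit_sub_of_mem_jacobson_bot {z u : S} (hz : z ∈ Ideal.jacobson (⊥ : Ideal S))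
    (hu : IsUnit u) : IsUnit (z - u) := by
  by_contra hzu
  obtain ⟨N, hN, hzuN⟩ := exists_max_ideal_of_mem_nonunits hzu
  have hzN := mem_jacobson_bot_iff_forall_isMaximal.1 hz N hN
  exact hN.ne_top (N.eq_top_of_isUnit_mem (by simpa using N.sub_mem hzN hzuN) hu)

variable [IsLocalRing R]

theorem algebraMap_mem_jacobson_bot_iff [Nontrivial S] [Algebra.IsIntegral R S] {r : R} :
    algebraMap R S r ∈ Ideal.jacobson (⊥ : Ideal S) ↔ r ∈ maximalIdeal R := by
  rw [mem_jacobson_bot_iff_forall_isMaximal]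
  refine ⟨fun h => ?_, fun h N hN => (algebraMap_mem_iff_of_isMaximal hN).2 h⟩
  obtain ⟨N, hN⟩ := Ideal.exists_maximal S
  exact (algebraMap_mem_iff_of_isMaximal hN).1 (h N hN)

theorem mem_or_isUnit_algebraMap (r : R) : r ∈ maximalIdeal R ∨ IsUnit (algebraMap R S r) :=
  or_iff_not_imp_left.2 fun hr => (notMem_maximalIdeal.1 hr).map (algebraMap R S)

namespace IsQuadraticExtension

theorem mul_self_sub_self_mem_map (h : IsQuadraticExtension R S) {N₁ N₂ : Ideal S}
    (h₁ : N₁.IsMaximal) (h₂ : N₂.IsMaximal) {w : S} (hw₁ : w ∈ N₁) (hw₂ : w - 1 ∈ N₂) :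
    w * w - w ∈ (maximalIdeal R).map (algebraMap R S) := by
  have := h.isIntegral
  obtain ⟨a, b, c, hww⟩ := h w w
  rw [← add_smul, Algebra.smul_def] at hww
  have hc : c ∈ maximalIdeal R := (algebraMap_mem_iff_of_isMaximal h₁).1 <| by
    rw [← sub_eq_of_eq_add' hww]
    exact N₁.sub_mem (N₁.mul_mem_left _ hw₁) (N₁.mul_mem_left _ hw₁)
  have hab : a + b - 1 ∈ maximalIdeal R := (algebraMap_mem_iff_of_isMaximal h₂).1 <| by
    convert N₂.sub_mem (N₂.mul_mem_left (w + 1 - algebraMap R S (a + b)) hw₂)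
      ((algebraMap_mem_iff_of_isMaximal h₂).2 hc) using 1
    rw [map_sub, map_one]
    linear_combination -hww
  convert Ideal.add_mem _ (Ideal.mul_mem_left _ w (Ideal.mem_map_of_mem (algebraMap R S) hab))
    (Ideal.mem_map_of_mem (algebraMap R S) hc) using 1
  rw [map_sub, map_one]
  linear_combination hww

variable [Nontrivial S]

theorem mul_self_mem_of_mem_jacobson_bot (h : IsQuadraticExtension R S) {z : S}
    (hz : z ∈ Ideal.jacobson (⊥ : Ideal S)) : z * z ∈ (maximalIdeal R).map (algebraMap R S) := by
  have := h.isIntegral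
  obtain ⟨a, b, c, hzz⟩ := h z z
  rw [← add_smul, Algebra.smul_def] at hzz
  have hc : c ∈ maximalIdeal R := algebraMap_mem_jacobson_bot_iff.1 <| by
    rw [← sub_eq_of_eq_add' hzz]
    exact Ideal.sub_mem _ (Ideal.mul_mem_left _ _ hz) (Ideal.mul_mem_left _ _ hz)
  have hcX := Ideal.mem_map_of_mem (algebraMap R S) hc
  rcases mem_or_isUnit_algebraMap (S := S) (a + b) with hs | hs
  · rw [hzz]
    exact Ideal.add_mem _ (Ideal.mul_mem_right _ _ (Ideal.mem_map_of_mem _ hs)) hcX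
  · refine Ideal.mul_mem_right _ _
      ((Ideal.mul_unit_mem_iff_mem _ (isUnit_sub_of_mem_jacobson_bot hz hs)).1 ?_)
    rwa [show z * (z - algebraMap R S (a + b)) = algebraMap R S c by linear_combination hzz]

theorem jacobson_bot_mul_self_le (h : IsQuadraticExtension R S) :
    Ideal.jacobson (⊥ : Ideal S) * Ideal.jacobson ⊥ ≤ (maximalIdeal R).map (algebraMap R S) := by
  have := h.isIntegral
  refine Ideal.mul_le.2 fun z hz w hw => ?_
  obtain ⟨a, b, c, hzw⟩ := h z w
  rw [Algebra.smul_def, Algebra.smul_def] at hzw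
  have hc : c ∈ maximalIdeal R := algebraMap_mem_jacobson_bot_iff.1 <| by
    rw [← sub_eq_of_eq_add' hzw]
    exact Ideal.sub_mem _ (Ideal.mul_mem_left _ _ hw)
      (Ideal.add_mem _ (Ideal.mul_mem_left _ _ hz) (Ideal.mul_mem_left _ _ hw))
  set X := (maximalIdeal R).map (algebraMap R S)
  have hcX : algebraMap R S c ∈ X := Ideal.mem_map_of_mem _ hc
  have hzz : z * z ∈ X := h.mul_self_mem_of_mem_jacobson_bot hz
  have hww : w * w ∈ X := h.mul_self_mem_of_mem_jacobson_bot hw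
  have ha : algebraMap R S a * (z * w) ∈ X := by
    convert X.sub_mem (X.mul_mem_left (z - algebraMap R S b) hww) (X.mul_mem_right w hcX) using 1
    linear_combination -w * hzw
  have hb : algebraMap R S b * (z * w) ∈ X := by
    convert X.sub_mem (X.mul_mem_left (w - algebraMap R S a) hzz) (X.mul_mem_right z hcX) using 1
    linear_combination -z * hzw
  rcases mem_or_isUnit_algebraMap (S := S) a with haM | haU
  · rcases mem_or_isUnit_algebraMap (S := S) b with hbM | hbU
    · rw [hzw]
      exact X.add_mem (X.add_mem (X.mul_mem_right _ (Ideal.mem_map_of_mem _ haM))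
        (X.mul_mem_right _ (Ideal.mem_map_of_mem _ hbM))) hcX
    · exact (X.unit_mul_mem_iff_mem hbU).1 hb
  · exact (X.unit_mul_mem_iff_mem haU).1 ha

theorem jacobson_bot_le_map_maximalIdeal (h : IsQuadraticExtension R S) {N₁ N₂ : Ideal S}
    (h₁ : N₁.IsMaximal) (h₂ : N₂.IsMaximal) (hne : N₁ ≠ N₂) :
    Ideal.jacobson ⊥ ≤ (maximalIdeal R).map (algebraMap R S) := by
  intro z hz
  set X := (maximalIdeal R).map (algebraMap R S)
  have hzN := mem_jacobson_bot_iff_forall_isMaximal.1 hz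
  obtain ⟨a, ha, b, hb, hab⟩ := Submodule.mem_sup.1
    ((Ideal.eq_top_iff_one _).1 (h₁.coprime_of_ne h₂ hne))
  obtain rfl : b = 1 - a := eq_sub_of_add_eq' hab
  have ha₂ : a - 1 ∈ N₂ := neg_sub 1 a ▸ N₂.neg_mem hb
  have hzz : z * z ∈ X := h.mul_self_mem_of_mem_jacobson_bot hz
  have haa : a * a - a ∈ X := h.mul_self_sub_self_mem_map h₁ h₂ ha ha₂
  have hza : (z + a) * (z + a) - (z + a) ∈ X :=
    h.mul_self_sub_self_mem_map h₁ h₂ (N₁.add_mem (hzN _ h₁) ha)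
      (add_sub_assoc z a 1 ▸ N₂.add_mem (hzN _ h₂) ha₂)
  have h2a : (2 * a - 1) * z ∈ X := by
    convert X.sub_mem (X.sub_mem hza haa) hzz using 1
    ring
  -- `2a - 1` squares to `1` modulo `X`
  convert X.sub_mem (X.mul_mem_left (2 * a - 1) h2a) (X.mul_mem_left (4 * z) haa) using 1
  ring

end IsQuadraticExtension

end JacobsonRadical

section Dedekind

variable {A K : Type*} [CommRing A] [CommRing K] [Algebra A K] [IsFractionRing A K]

theorem isUnit_coeIdeal_of_mul_le {N T : Ideal A} (hN : N.IsMaximal)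
    (hNu : IsUnit (N : FractionalIdeal A⁰ K))
    (hT : ∀ I : Ideal A, T ≤ I → IsUnit (I : FractionalIdeal A⁰ K)) {I : Ideal A}
    (hI : N * T ≤ I) : IsUnit (I : FractionalIdeal A⁰ K) := by
  by_cases hIN : I ≤ N
  · obtain ⟨F, hF⟩ := hNu.exists_left_inv
    have hle : F * (I : FractionalIdeal A⁰ K) ≤ 1 :=
      hF ▸ mul_le_mul_right ((FractionalIdeal.coeIdeal_le_coeIdeal K).2 hIN) F
    obtain ⟨J, hJ⟩ := FractionalIdeal.le_one_iff_exists_coeIdeal.1 hle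
    have hTJ : T ≤ J := by
      rw [← FractionalIdeal.coeIdeal_le_coeIdeal K, hJ, ← one_mul (T : FractionalIdeal A⁰ K), ← hF,
        mul_assoc, ← FractionalIdeal.coeIdeal_mul]
      exact mul_le_mul_right ((FractionalIdeal.coeIdeal_le_coeIdeal K).2 hI) F
    exact isUnit_of_mul_isUnit_right (hJ ▸ hT J hTJ)
  · refine hT I ?_
    calc T = T * (N ⊔ I) := by rw [hN.out.2 _ (left_lt_sup.2 hIN), Ideal.mul_top]
      _ ≤ I := by
        rw [Ideal.mul_sup, mul_comm]
        exact sup_le hI Ideal.mul_le_right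

theorem isUnit_coeIdeal_of_multiset_prod_le {s : Multiset (Ideal A)}
    (hs : ∀ N ∈ s, N.IsMaximal ∧ IsUnit (N : FractionalIdeal A⁰ K)) {I : Ideal A}
    (hI : s.prod ≤ I) : IsUnit (I : FractionalIdeal A⁰ K) := by
  induction s using Multiset.induction_on generalizing I with
  | empty =>
    rw [Multiset.prod_zero, Ideal.one_eq_top, top_le_iff] at hI
    rw [hI, FractionalIdeal.coeIdeal_top]
    exact isUnit_one
  | cons N s ih =>
    obtain ⟨⟨hN, hNu⟩, hs⟩ := Multiset.forall_mem_cons.1 hs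
    exact isUnit_coeIdeal_of_mul_le hN hNu (fun I => ih hs) (Multiset.prod_cons N s ▸ hI)

theorem isUnit_coeIdeal_span_singleton {p : A} (hp : p ∈ A⁰) :
    IsUnit (Ideal.span {p} : FractionalIdeal A⁰ K) := by
  rw [FractionalIdeal.coeIdeal_span_singleton]
  obtain ⟨b, hb⟩ := (IsLocalization.map_units K ⟨p, hp⟩).exists_right_inv
  refine IsUnit.of_mul_eq_one (FractionalIdeal.spanSingleton _ b) ?_
  rw [FractionalIdeal.spanSingleton_mul_spanSingleton, hb, FractionalIdeal.spanSingleton_one]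

theorem isDedekindRegular_of_jacobson_bot_eq_span [Finite (MaximalSpectrum A)]
    [Ring.KrullDimLE 1 A] {p : A} (hp : p ∈ A⁰) (hJ : Ideal.jacobson ⊥ = Ideal.span {p}) :
    IsDedekindRegular A := by
  rintro I ⟨s, hsI, hs⟩
  cases nonempty_fintype (MaximalSpectrum A)
  obtain ⟨n, hn⟩ := exists_dvd_pow_of_mem_jacobson_bot hs (hJ ▸ Ideal.mem_span_singleton_self p)
  have hprod : ∏ N : MaximalSpectrum A, N.asIdeal = Ideal.span {p} := by
    rw [Ideal.prod_eq_iInf_of_pairwise_isCoprime fun N _ N' _ hne => Ideal.isCoprime_of_isMaximal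
      (mt MaximalSpectrum.ext hne), ← hJ]
    ext x
    simp [mem_jacobson_bot_iff_forall_isMaximal, (MaximalSpectrum.equivSubtype A).forall_congr_left]
  have hu (N : MaximalSpectrum A) :
      IsUnit (N.asIdeal : FractionalIdeal A⁰ (FractionRing A)) :=
    isUnit_of_dvd_unit (map_dvd (FractionalIdeal.coeIdealHom A⁰ (FractionRing A))
      (hprod ▸ Finset.dvd_prod_of_mem MaximalSpectrum.asIdeal (Finset.mem_univ N)))
      (isUnit_coeIdeal_span_singleton hp)
  refine isUnit_coeIdeal_of_multiset_prod_le
    (s := n • Finset.univ.val.map MaximalSpectrum.asIdeal) (fun N hN => ?_) ?_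
  · obtain ⟨N, -, rfl⟩ := Multiset.mem_map.1 (Multiset.mem_of_mem_nsmul hN)
    exact ⟨N.isMaximal, hu N⟩
  · rw [Multiset.prod_nsmul, ← Finset.prod_eq_multiset_prod, hprod, Ideal.span_singleton_pow,
      Ideal.span_singleton_le_iff_mem]
    exact I.mem_of_dvd hn hsI

namespace IsDedekindRegular

theorem isUnit_coeIdeal (h : IsDedekindRegular A) {I : Ideal A} (hI : IsRegularIdeal I) :
    IsUnit (I : FractionalIdeal A⁰ K) := by
  rw [← FractionalIdeal.canonicalEquiv_coeIdeal A⁰ (FractionRing A) K I]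
  exact (h I hI).map _

theorem isUnit_fractionalIdeal (h : IsDedekindRegular A) {F : FractionalIdeal A⁰ K} {v : K}
    (hv : v ∈ F) (hvu : IsUnit v) : IsUnit F := by
  have hnum := FractionalIdeal.den_mul_self_eq_num' A⁰ K F
  refine isUnit_of_mul_isUnit_right (hnum ▸ h.isUnit_coeIdeal ?_)
  have hmem : algebraMap A K F.den * v ∈ (F.num : FractionalIdeal A⁰ K) :=
    hnum ▸ FractionalIdeal.mul_mem_mul (FractionalIdeal.mem_spanSingleton_self _ _) hv
  obtain ⟨x, hx, hxv⟩ := (FractionalIdeal.mem_coeIdeal _).1 hmem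
  refine ⟨x, hx, mem_nonZeroDivisors_of_injective (IsFractionRing.injective A K) ?_⟩
  rw [hxv]
  exact ((IsLocalization.map_units K F.den).mul hvu).mem_nonZeroDivisors

theorem mem_range_algebraMap_of_isIntegral (h : IsDedekindRegular A) {q : K}
    (hq : IsIntegral A q) : q ∈ (algebraMap A K).range := by
  let F := FractionalIdeal.adjoinIntegral A⁰ q hq
  have hF : IsUnit F := h.isUnit_fractionalIdeal (Algebra.adjoin A {q}).one_mem isUnit_one
  have hFF : F * F = F * 1 := by
    apply FractionalIdeal.coeToSubmodule_injective
    simp only [FractionalIdeal.coe_mul, mul_one, FractionalIdeal.adjoinIntegral_coe, F]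
    exact (Algebra.adjoin A {q}).isIdempotentElem_toSubmodule
  have hq1 : q ∈ (1 : FractionalIdeal A⁰ K) :=
    hF.mul_left_cancel hFF ▸ FractionalIdeal.mem_adjoinIntegral_self A⁰ q hq
  exact (FractionalIdeal.mem_one_iff _).1 hq1

end IsDedekindRegular

end Dedekind

section TowerUnion

variable {R S Q : Type*} [CommRing R] [CommRing S] [CommRing Q] [Algebra R S] [Algebra R Q]

theorem isFractionRing_subalgebra [IsFractionRing R Q] (A : Subalgebra R Q) :
    IsFractionRing A Q where
  map_units p := by
    obtain ⟨⟨a, s⟩, hs⟩ := IsLocalization.surj R⁰ (p : Q)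
    have hps : (p : A) * algebraMap R A s = algebraMap R A a := Subtype.ext hs
    have hsA : algebraMap R A s ∈ A⁰ := mem_nonZeroDivisors_of_injective (f := A.val)
      Subtype.val_injective (IsLocalization.map_units Q s).mem_nonZeroDivisors
    have hinj : Function.Injective (algebraMap R A) := fun _ _ h =>
      IsFractionRing.injective R Q (congrArg Subtype.val h)
    have ha : a ∈ R⁰ := mem_nonZeroDivisors_of_injective hinj (hps ▸ mul_mem p.2 hsA)
    exact isUnit_of_mul_isUnit_left (hs ▸ IsLocalization.map_units Q ⟨a, ha⟩)
  surj q := by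
    obtain ⟨⟨a, s⟩, hs⟩ := IsLocalization.surj R⁰ q
    exact ⟨⟨algebraMap R A a, algebraMap R A s, mem_nonZeroDivisors_of_injective (f := A.val)
      Subtype.val_injective (IsLocalization.map_units Q s).mem_nonZeroDivisors⟩, hs⟩
  exists_of_eq h := ⟨1, by rw [Subtype.ext h]⟩

theorem map_algebraMap_eq_span_singleton_of_le {A B : Subalgebra R Q} (hAB : A ≤ B) {I : Ideal R}
    {x : R} (h : I.map (algebraMap R A) = Ideal.span {algebraMap R A x}) :
    I.map (algebraMap R B) = Ideal.span {algebraMap R B x} := by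
  rw [show algebraMap R B = (Subalgebra.inclusion hAB : A →+* B).comp (algebraMap R A) from rfl,
    ← Ideal.map_map, h, Ideal.map_span, Set.image_singleton]
  rfl

theorem IsDedekindRegular.integralClosure_le [IsFractionRing R Q] {A : Subalgebra R Q}
    (h : IsDedekindRegular A) : integralClosure R Q ≤ A := by
  have := isFractionRing_subalgebra A
  intro q hq
  obtain ⟨a, rfl⟩ := h.mem_range_algebraMap_of_isIntegral (hq.tower_top (A := A))
  exact a.2

variable [IsLocalRing R]

theorem jacobsonRadicalIn_bot [Nontrivial Q] :
    jacobsonRadicalIn (⊥ : Subalgebra R Q) =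
      Submodule.map (Algebra.linearMap R Q) (maximalIdeal R) := by
  ext q
  constructor
  · rintro ⟨⟨_, a, rfl⟩, ha, rfl⟩
    exact ⟨a, algebraMap_mem_jacobson_bot_iff.1 ha, rfl⟩
  · rintro ⟨r, hr, rfl⟩
    exact ⟨algebraMap R _ r, algebraMap_mem_jacobson_bot_iff.2 hr, rfl⟩

theorem IsStableIdeal.exists_map_maximalIdeal_eq_span [IsFractionRing R Q]
    (h : IsStableIdeal (maximalIdeal R)) (hreg : IsRegularIdeal (maximalIdeal R))
    (h2 : HasAtMostTwoMaximalIdeals (jacobsonTower R Q 1)) :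
    ∃ x : R, IsUnit (algebraMap R Q x) ∧ (maximalIdeal R).map (algebraMap R (jacobsonTower R Q 1)) =
      Ideal.span {algebraMap R (jacobsonTower R Q 1) x} := by
  have : Nontrivial Q := (IsFractionRing.injective R Q).nontrivial
  set V := Submodule.map (Algebra.linearMap R Q) (maximalIdeal R) with hV
  have hE : jacobsonTower R Q 1 = multiplierRing V := by
    rw [hV, ← jacobsonRadicalIn_bot]; rfl
  rw [hE] at h2 ⊢
  obtain ⟨x, -, hx⟩ := h2.exists_map_eq_span (C := V / (V * V))
    (Submodule.mul_le.2 fun a ha b hb => Submodule.mem_div_iff_forall_mul_mem.2 fun y hy => by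
      induction hy using Submodule.mul_induction_on' with
      | mem_mul_mem y hy z hz =>
        simpa only [mul_assoc] using ha _ (mem_div_mul_self_iff.1 hb y hy z hz)
      | add y _ z _ ihy ihz => simpa only [mul_add] using V.add_mem ihy ihz)
    (Submodule.mul_le.2 fun a ha b hb => mul_mem_multiplierRing ha hb)
    (h.isStableSubmodule_map hreg)
  exact ⟨x, hx⟩

theorem IsQuadraticExtension.jacobson_bot_eq_span_of_mul_eq [Nontrivial S]
    (h : IsQuadraticExtension R S) {x z w t : S} (hx : x ∈ S⁰)
    (hM : (maximalIdeal R).map (algebraMap R S) = Ideal.span {x})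
    (hz : z ∈ Ideal.jacobson (⊥ : Ideal S)) (hw : w ∈ Ideal.jacobson (⊥ : Ideal S))
    (ht : IsUnit t) (hzw : z * w = x * t) :
    w ∈ S⁰ ∧ Ideal.jacobson (⊥ : Ideal S) = Ideal.span {w} := by
  obtain ⟨hz₀, hw₀⟩ := mul_mem_nonZeroDivisors.1 (hzw ▸ mul_mem hx ht.mem_nonZeroDivisors)
  refine ⟨hw₀, le_antisymm (fun v hv => ?_) ((Ideal.span_singleton_le_iff_mem _).2 hw)⟩
  have hzv := h.jacobson_bot_mul_self_le (Ideal.mul_mem_mul hz hv)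
  obtain ⟨u, hu⟩ := Ideal.mem_span_singleton.1 (hM ▸ hzv)
  obtain ⟨s, hs⟩ := ht.exists_right_inv
  refine Ideal.mem_span_singleton.2 ⟨s * u, (mul_cancel_left_mem_nonZeroDivisors hz₀).1 ?_⟩
  linear_combination hu - x * u * hs - s * u * hzw

-- An element `z` of the Jacobson radical of `Rᵢ` satisfies `z Jac(Rᵢ) ⊆ x Jac(Rᵢ)`, so `z / x`
-- lies in `Rᵢ₊₁`.
theorem IsQuadraticExtension.jacobson_bot_jacobsonTowerUnion_le_span [Nontrivial Q]
    (h : IsQuadraticExtension R (jacobsonTowerUnion R Q)) {x : R} (hx : IsUnit (algebraMap R Q x))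
    (hM : (maximalIdeal R).map (algebraMap R (jacobsonTower R Q 1)) =
      Ideal.span {algebraMap R (jacobsonTower R Q 1) x})
    (hJ : ∀ z ∈ Ideal.jacobson (⊥ : Ideal (jacobsonTowerUnion R Q)), ∀ w ∈ Ideal.jacobson ⊥,
      ∀ t, z * w = algebraMap R _ x * t → t ∈ Ideal.jacobson ⊥) :
    Ideal.jacobson (⊥ : Ideal (jacobsonTowerUnion R Q)) ≤ Ideal.span {algebraMap R _ x} := by
  intro z hz
  have := h.isIntegral
  have hle (i : ℕ) : jacobsonTower R Q i ≤ jacobsonTowerUnion R Q := le_iSup _ i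
  have hmono := monotone_nat_of_le_succ (jacobsonTower_le_succ R Q)
  obtain ⟨y, hy⟩ := hx.exists_left_inv
  obtain ⟨i, hi⟩ := Set.mem_iUnion.1 ((coe_jacobsonTowerUnion R Q).subset z.2)
  set T := jacobsonTower R Q (i + 1)
  have hQT : IsQuadraticExtension R T :=
    h.of_injective (Subalgebra.inclusion (hle _)) (Subalgebra.inclusion_injective _)
  have hJT {v : T} : Subalgebra.inclusion (hle (i + 1)) v ∈ Ideal.jacobson ⊥ ↔
      v ∈ Ideal.jacobson ⊥ :=
    map_mem_jacobson_bot_iff (inclusion_isIntegral (hle _)) (Subalgebra.inclusion_injective _)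
  have hMT := map_algebraMap_eq_span_singleton_of_le (hmono (Nat.le_add_left 1 i)) hM
  let z' : T := ⟨z, jacobsonTower_le_succ R Q i hi⟩
  have hyz : y * z ∈ jacobsonTower R Q (i + 2) := by
    rintro _ ⟨v, hv, rfl⟩
    have hzv := hQT.jacobson_bot_mul_self_le (Ideal.mul_mem_mul (hJT.1 hz : z' ∈ _) hv)
    obtain ⟨t, ht⟩ := Ideal.mem_span_singleton.1 (hMT ▸ hzv)
    have ht' : (z * v : Q) = algebraMap R Q x * t := congrArg Subtype.val ht
    refine ⟨t, hJT.1 (hJ z hz _ (hJT.2 hv) _ (Subtype.ext ht')), ?_⟩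
    change (t : Q) = y * z * v
    rw [mul_assoc, ht', ← mul_assoc, hy, one_mul]
  refine Ideal.mem_span_singleton.2 ⟨⟨y * z, hle _ hyz⟩, Subtype.ext ?_⟩
  change (z : Q) = algebraMap R Q x * (y * z)
  rw [← mul_assoc, mul_comm _ y, hy, one_mul]

theorem IsQuadraticExtension.exists_jacobson_bot_jacobsonTowerUnion_eq_span [Nontrivial Q]
    (h : IsQuadraticExtension R (jacobsonTowerUnion R Q)) {x : R} (hx : IsUnit (algebraMap R Q x))
    (hM : (maximalIdeal R).map (algebraMap R (jacobsonTower R Q 1)) =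
      Ideal.span {algebraMap R (jacobsonTower R Q 1) x}) :
    ∃ p ∈ (jacobsonTowerUnion R Q)⁰,
      Ideal.jacobson (⊥ : Ideal (jacobsonTowerUnion R Q)) = Ideal.span {p} := by
  have := h.isIntegral
  set A := jacobsonTowerUnion R Q
  have hxA : algebraMap R A x ∈ A⁰ := mem_nonZeroDivisors_of_injective (f := A.val)
    Subtype.val_injective hx.mem_nonZeroDivisors
  have hMA : (maximalIdeal R).map (algebraMap R A) = Ideal.span {algebraMap R A x} :=
    map_algebraMap_eq_span_singleton_of_le (le_iSup (jacobsonTower R Q) 1) hM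
  have hxJ : Ideal.span {algebraMap R A x} ≤ Ideal.jacobson ⊥ :=
    hMA ▸ Ideal.map_le_iff_le_comap.2 fun r hr => algebraMap_mem_jacobson_bot_iff.2 hr
  by_cases hloc : ∃ N₁ N₂ : Ideal A, N₁.IsMaximal ∧ N₂.IsMaximal ∧ N₁ ≠ N₂
  · obtain ⟨N₁, N₂, h₁, h₂, hne⟩ := hloc
    exact ⟨_, hxA, le_antisymm (hMA ▸ h.jacobson_bot_le_map_maximalIdeal h₁ h₂ hne) hxJ⟩
  have hJ {t : A} (ht : ¬ IsUnit t) : t ∈ Ideal.jacobson ⊥ := by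
    obtain ⟨N, hN, htN⟩ := exists_max_ideal_of_mem_nonunits ht
    exact mem_jacobson_bot_iff_forall_isMaximal.2 fun N' hN' =>
      (by_contra fun hne => hloc ⟨N, N', hN, hN', hne⟩ : N = N') ▸ htN
  by_cases hu : ∃ z ∈ Ideal.jacobson (⊥ : Ideal A), ∃ w ∈ Ideal.jacobson (⊥ : Ideal A),
      ∃ t, IsUnit t ∧ z * w = algebraMap R A x * t
  · obtain ⟨z, hz, w, hw, t, ht, hzw⟩ := hu
    exact ⟨w, h.jacobson_bot_eq_span_of_mul_eq hxA hMA hz hw ht hzw⟩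
  · exact ⟨_, hxA, le_antisymm (h.jacobson_bot_jacobsonTowerUnion_le_span hx hM
      fun z hz w hw t hzw => hJ fun ht => hu ⟨z, hz, w, hw, t, ht, hzw⟩) hxJ⟩

theorem IsStableIdeal.isDedekindRegular_jacobsonTowerUnion [IsFractionRing R Q]
    [Ring.KrullDimLE 1 R] (hM : IsStableIdeal (maximalIdeal R))
    (hreg : IsRegularIdeal (maximalIdeal R)) (h : IsQuadraticExtension R (jacobsonTowerUnion R Q))
    (h2 : HasAtMostTwoMaximalIdeals (jacobsonTowerUnion R Q)) :
    IsDedekindRegular (jacobsonTowerUnion R Q) := by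
  have : Nontrivial Q := (IsFractionRing.injective R Q).nontrivial
  have := h.isIntegral
  have := h2.finite_maximalSpectrum
  have := krullDimLE_one_of_isIntegral (A := R) (B := jacobsonTowerUnion R Q)
  obtain ⟨x, hxu, hx⟩ := hM.exists_map_maximalIdeal_eq_span (Q := Q) hreg <|
    h2.of_isIntegral (inclusion_isIntegral (B := jacobsonTowerUnion R Q) (le_iSup _ 1))
      (Subalgebra.inclusion_injective _)
  obtain ⟨p, hp, hJ⟩ := h.exists_jacobson_bot_jacobsonTowerUnion_eq_span hxu hx
  exact isDedekindRegular_of_jacobson_bot_eq_span hp hJ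

end TowerUnion

section DedekindOverring

variable {R Q : Type*} [CommRing R] [CommRing Q] [Algebra R Q] {A : Subalgebra R Q}

theorem one_mem_mul_div_of_isUnit_coeIdeal_map {I : Ideal R}
    (h : IsUnit (I.map (algebraMap R A) : FractionalIdeal A⁰ Q)) :
    1 ∈ Submodule.map (Algebra.linearMap R Q) I *
      (A.toSubmodule / Submodule.map (Algebra.linearMap R Q) I) := by
  set V := Submodule.map (Algebra.linearMap R Q) I
  obtain ⟨F, hF⟩ := h.exists_right_inv
  have hmul {t : A} (ht : t ∈ I.map (algebraMap R A)) {f : Q} (hf : f ∈ F) : (t * f : Q) ∈ A := by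
    have htf := FractionalIdeal.mul_mem_mul (FractionalIdeal.mem_coeIdeal_of_mem A⁰ ht) hf
    rw [hF, FractionalIdeal.mem_one_iff] at htf
    obtain ⟨a, ha⟩ := htf
    exact ha ▸ a.2
  have hFC {f : Q} (hf : f ∈ F) : f ∈ A.toSubmodule / V := by
    rintro _ ⟨a, ha, rfl⟩
    exact mul_comm f _ ▸ hmul (Ideal.mem_map_of_mem _ ha) hf
  have hVC {t : A} (ht : t ∈ I.map (algebraMap R A)) :
      ∀ f ∈ F, (t * f : Q) ∈ V * (A.toSubmodule / V) := by
    induction ht using Submodule.span_induction with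
    | mem t ht =>
      obtain ⟨a, ha, rfl⟩ := ht
      exact fun f hf => Submodule.mul_mem_mul (Submodule.mem_map_of_mem ha) (hFC hf)
    | zero => simp
    | add s t _ _ hs ht => exact fun f hf => by simpa [add_mul] using add_mem (hs f hf) (ht f hf)
    | smul a t _ ht =>
      intro f hf
      convert ht (a • f) (F.val.smul_mem a hf) using 1
      change (a * t : Q) * f = t * (a * f)
      ring
  have h1 : (1 : Q) ∈ (I.map (algebraMap R A) : FractionalIdeal A⁰ Q) * F :=
    hF ▸ FractionalIdeal.one_mem_one A⁰
  refine FractionalIdeal.mul_induction_on (C := (· ∈ V * (A.toSubmodule / V))) h1 ?_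
    fun _ _ => add_mem
  intro _ hx f hf
  obtain ⟨t, ht, rfl⟩ := (FractionalIdeal.mem_coeIdeal _).1 hx
  exact hVC ht f hf

theorem IsQuadraticExtension.isStableIdeal_of_map_eq_span {S : Type*} [CommRing S] [Algebra R S]
    [FaithfulSMul R S] (h : IsQuadraticExtension R S) {I : Ideal R} {u : R} (hu : u ∈ I)
    (hu₀ : u ∈ R⁰) (hI : I.map (algebraMap R S) = Ideal.span {algebraMap R S u}) :
    IsStableIdeal I := by
  have hdvd {x : R} (hx : x ∈ I) : algebraMap R S u ∣ algebraMap R S x :=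
    Ideal.mem_span_singleton.1 (hI ▸ Ideal.mem_map_of_mem _ hx)
  refine isStableIdeal_of_mul_eq_mul hu₀ hu fun x hx y hy => ?_
  obtain ⟨s, hs⟩ := hdvd hx
  obtain ⟨t, ht⟩ := hdvd hy
  obtain ⟨a, b, c, hst⟩ := h s t
  simp only [Algebra.smul_def] at hst
  refine ⟨a * x + b * y + c * u, I.add_mem (I.add_mem (I.mul_mem_left _ hx) (I.mul_mem_left _ hy))
    (I.mul_mem_left _ hu), FaithfulSMul.algebraMap_injective R S ?_⟩
  simp only [map_mul, map_add, hs, ht]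
  linear_combination algebraMap R S u * algebraMap R S u * hst

theorem IsQuadraticExtension.isStableRing [IsFractionRing R Q] [Nontrivial Q]
    (h : IsQuadraticExtension R A) (hD : IsDedekindRegular A)
    (h2 : HasAtMostTwoMaximalIdeals A) : IsStableRing R := by
  rintro I ⟨a, ha, ha₀⟩
  have := isFractionRing_subalgebra A
  have hI : IsRegularIdeal (I.map (algebraMap R A)) :=
    ⟨algebraMap R A a, Ideal.mem_map_of_mem _ ha, mem_nonZeroDivisors_of_injective (f := A.val)
      Subtype.val_injective (IsLocalization.map_units Q ⟨a, ha₀⟩).mem_nonZeroDivisors⟩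
  set V := Submodule.map (Algebra.linearMap R Q) I
  obtain ⟨u, hu, huu, hIu⟩ := h2.exists_map_eq_span (C := A.toSubmodule / V)
    (Submodule.mul_le.2 fun b hb c hc => Submodule.mem_div_iff_forall_mul_mem.2 fun x hx =>
      (mul_assoc b c x).symm ▸ A.mul_mem hb (hc x hx))
    ((mul_comm V _).trans_le (Submodule.le_div_iff_mul_le.1 le_rfl))
    (one_mem_mul_div_of_isUnit_coeIdeal_map (hD.isUnit_coeIdeal hI))
  have hinj : Function.Injective (algebraMap R A) := fun _ _ hxy =>
    IsFractionRing.injective R Q (congrArg Subtype.val hxy)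
  have : FaithfulSMul R A := (faithfulSMul_iff_algebraMap_injective R A).2 hinj
  exact h.isStableIdeal_of_map_eq_span hu (mem_nonZeroDivisors_of_injective
    (IsFractionRing.injective R Q) huu.mem_nonZeroDivisors) hIu

end DedekindOverring

section Quotient

variable {R S : Type*} [CommRing R] [CommRing S]

theorem comap_quadraticColon {f : R →+* S} (hf : Function.Surjective f) {s : R} {I : Ideal R}
    (hker : RingHom.ker f ≤ Ideal.span {s} * I) :
    (quadraticColon (f s) (I.map f)).comap f = quadraticColon s I := by
  ext b
  simp only [Ideal.mem_comap, mem_quadraticColon_iff]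
  refine ⟨fun h x hx y hy => ?_, fun h _ hx' _ hy' => ?_⟩
  · obtain ⟨_, hw', hbw⟩ := h _ (Ideal.mem_map_of_mem f hx) _ (Ideal.mem_map_of_mem f hy)
    obtain ⟨w, hw, rfl⟩ := (Ideal.mem_map_iff_of_surjective f hf).1 hw'
    obtain ⟨v, hv, hsv⟩ := Ideal.mem_span_singleton_mul.1 (hker
      (show b * x * y - s * w ∈ RingHom.ker f by simp [RingHom.mem_ker, hbw]))
    exact ⟨w + v, I.add_mem hw hv, by linear_combination -hsv⟩
  · obtain ⟨x, hx, rfl⟩ := (Ideal.mem_map_iff_of_surjective f hf).1 hx'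
    obtain ⟨y, hy, rfl⟩ := (Ideal.mem_map_iff_of_surjective f hf).1 hy'
    obtain ⟨w, hw, hbw⟩ := h x hx y hy
    exact ⟨f w, Ideal.mem_map_of_mem f hw, by simp only [← map_mul, hbw]⟩

theorem map_mem_map_mul_quadraticColon_iff {f : R →+* S} (hf : Function.Surjective f) {s : R}
    {I : Ideal R} (hker : RingHom.ker f ≤ Ideal.span {s} * I)
    (hker' : RingHom.ker f ≤ I * quadraticColon s I) :
    f s ∈ I.map f * quadraticColon (f s) (I.map f) ↔ s ∈ I * quadraticColon s I := by
  rw [← Ideal.map_comap_of_surjective f hf (quadraticColon (f s) (I.map f)),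
    comap_quadraticColon hf hker, ← Ideal.map_mul, ← Ideal.mem_comap,
    Ideal.comap_map_of_surjective' f hf, sup_eq_left.2 hker']

-- In `s ∈ I * quadraticColon s I` the element `s` may be replaced by any multiple, and it divides
-- a power of `m`.
theorem isStableIdeal_iff_exists_pow [IsLocalRing R] [Ring.KrullDimLE 1 R] {m : R}
    (hm : m ∈ maximalIdeal R) (hreg : m ∈ R⁰) {I : Ideal R} (hI : IsRegularIdeal I) :
    IsStableIdeal I ↔ ∃ n, m ^ n ∈ I * quadraticColon (m ^ n) I := by
  refine ⟨fun h => ?_, fun ⟨n, hn⟩ => isStableIdeal_of_mem_mul_quadraticColon (pow_mem hreg n) hn⟩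
  obtain ⟨s, hs, hsI⟩ := h.exists_mem_mul_quadraticColon hI
  rw [← IsLocalRing.jacobson_eq_maximalIdeal ⊥ bot_ne_top] at hm
  obtain ⟨n, t, ht⟩ := exists_dvd_pow_of_mem_jacobson_bot hs hm
  have hle : Ideal.span {t} * quadraticColon s I ≤ quadraticColon (m ^ n) I := by
    refine Ideal.span_singleton_mul_le_iff.2 fun b hb =>
      mem_quadraticColon_iff.2 fun x hx y hy => ?_
    obtain ⟨w, hw, hbw⟩ := mem_quadraticColon_iff.1 hb x hx y hy
    exact ⟨w, hw, by linear_combination t * hbw - w * ht⟩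
  refine ⟨n, Ideal.mul_mono le_rfl hle ?_⟩
  rw [mul_left_comm, ht, mul_comm s]
  exact Ideal.mul_mem_mul (Ideal.mem_span_singleton_self t) hsI

theorem IsRegularIdeal.exists_pow_mem [IsLocalRing R] [Ring.KrullDimLE 1 R] {m : R}
    (hm : m ∈ maximalIdeal R) {I : Ideal R} (hI : IsRegularIdeal I) : ∃ n, m ^ n ∈ I := by
  obtain ⟨s, hs, hs₀⟩ := hI
  rw [← IsLocalRing.jacobson_eq_maximalIdeal ⊥ bot_ne_top] at hm
  obtain ⟨n, hn⟩ := exists_dvd_pow_of_mem_jacobson_bot hs₀ hm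
  exact ⟨n, I.mem_of_dvd hn hs⟩

theorem iInf_span_pow_le_span_pow_mul {m : R} (hreg : m ∈ R⁰) (n : ℕ) :
    ⨅ i : ℕ, Ideal.span {m ^ i} ≤ Ideal.span {m ^ n} * ⨅ i : ℕ, Ideal.span {m ^ i} := by
  intro x hx
  simp only [Ideal.mem_span_singleton_mul, Submodule.mem_iInf, Ideal.mem_span_singleton] at hx ⊢
  obtain ⟨y, rfl⟩ := hx n
  refine ⟨y, fun i => ?_, rfl⟩
  obtain ⟨z, hz⟩ := hx (n + i)
  refine ⟨z, (mul_cancel_left_mem_nonZeroDivisors (pow_mem hreg n)).1 ?_⟩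
  rw [hz, pow_add, mul_assoc]

theorem map_mem_nonZeroDivisors_of_ker_le {f : R →+* S} (hf : Function.Surjective f)
    {m : R} (hreg : m ∈ R⁰) (hker : RingHom.ker f ≤ Ideal.span {m} * RingHom.ker f) :
    f m ∈ S⁰ := by
  rw [mem_nonZeroDivisors_iff_left]
  intro z hz
  obtain ⟨z, rfl⟩ := hf z
  rw [← map_mul, ← RingHom.mem_ker] at hz
  obtain ⟨y, hy, hzy⟩ := Ideal.mem_span_singleton_mul.1 (hker hz)
  rwa [← (mul_cancel_left_mem_nonZeroDivisors hreg).1 hzy]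

theorem isStableIdeal_map_iff [IsLocalRing R] [Ring.KrullDimLE 1 R] [IsLocalRing S]
    [Ring.KrullDimLE 1 S] {f : R →+* S} (hf : Function.Surjective f) {m : R}
    (hm : m ∈ maximalIdeal R) (hreg : m ∈ R⁰) (hfm : f m ∈ maximalIdeal S) (hfreg : f m ∈ S⁰)
    (hker : ∀ n, RingHom.ker f ≤ Ideal.span {m ^ n} * RingHom.ker f) {I : Ideal R} {k : ℕ}
    (hk : m ^ k ∈ I) : IsStableIdeal (I.map f) ↔ IsStableIdeal I := by
  have hfk : f m ^ k ∈ I.map f := map_pow f m k ▸ Ideal.mem_map_of_mem f hk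
  rw [isStableIdeal_iff_exists_pow hm hreg ⟨_, hk, pow_mem hreg k⟩,
    isStableIdeal_iff_exists_pow hfm hfreg ⟨_, hfk, pow_mem hfreg k⟩]
  refine exists_congr fun n => ?_
  have hkI : Ideal.span {m ^ k} ≤ I := (Ideal.span_singleton_le_iff_mem I).2 hk
  have hkerI : RingHom.ker f ≤ I := (hker k).trans (Ideal.mul_le_left.trans hkI)
  have hkern : RingHom.ker f ≤ Ideal.span {m ^ n} * I := (hker n).trans (Ideal.mul_mono_right hkerI)
  have hkerC : RingHom.ker f ≤ quadraticColon (m ^ n) I :=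
    comap_quadraticColon hf hkern ▸ Ideal.ker_le_comap f
  rw [← map_pow]
  exact map_mem_map_mul_quadraticColon_iff hf hkern ((hker k).trans (Ideal.mul_mono hkI hkerC))

theorem isStableRing_iff_of_surjective [IsLocalRing R] [Nontrivial S] [Ring.KrullDimLE 1 R]
    {f : R →+* S} (hf : Function.Surjective f) {m : R} (hm : m ∈ maximalIdeal R) (hreg : m ∈ R⁰)
    (hker : ∀ n, RingHom.ker f ≤ Ideal.span {m ^ n} * RingHom.ker f) :
    IsStableRing R ↔ IsStableRing S := by
  have : IsLocalRing S := IsLocalRing.of_surjective' f hf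
  have : Ring.KrullDimLE 1 S := Ring.krullDimLE_iff.2
    ((ringKrullDim_le_of_surjective f hf).trans (Ring.krullDimLE_iff.1 ‹_›))
  have := IsLocalHom.of_surjective f hf
  have hfm : f m ∈ maximalIdeal S := (map_mem_nonunits_iff f m).2 hm
  have hfreg : f m ∈ S⁰ := map_mem_nonZeroDivisors_of_ker_le hf hreg (by simpa using hker 1)
  refine ⟨fun h I hI => ?_, fun h I hI => ?_⟩
  · obtain ⟨k, hk⟩ := hI.exists_pow_mem hfm
    have hkI : m ^ k ∈ I.comap f := by rwa [Ideal.mem_comap, map_pow]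
    rw [← Ideal.map_comap_of_surjective f hf I, isStableIdeal_map_iff hf hm hreg hfm hfreg hker hkI]
    exact h _ ⟨_, hkI, pow_mem hreg k⟩
  · obtain ⟨k, hk⟩ := hI.exists_pow_mem hm
    have hfk : f m ^ k ∈ I.map f := map_pow f m k ▸ Ideal.mem_map_of_mem f hk
    exact (isStableIdeal_map_iff hf hm hreg hfm hfreg hker hk).1 (h _ ⟨_, hfk, pow_mem hfreg k⟩)

theorem isStableRing_iff_quotient_iInf_span_pow [IsLocalRing R] [Ring.KrullDimLE 1 R] {m : R}
    (hm : m ∈ maximalIdeal R) (hreg : m ∈ R⁰) :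
    IsStableRing R ↔ IsStableRing (R ⧸ ⨅ i : ℕ, Ideal.span {m ^ i}) := by
  have hne : ⨅ i : ℕ, Ideal.span {m ^ i} ≠ ⊤ := fun htop =>
    hm (Ideal.span_singleton_eq_top.1 (top_le_iff.1 (htop.ge.trans
      ((iInf_le _ 1).trans_eq (by rw [pow_one])))))
  have := Ideal.Quotient.nontrivial_iff.2 hne
  refine isStableRing_iff_of_surjective Ideal.Quotient.mk_surjective hm hreg ?_
  simpa only [Ideal.mk_ker] using iInf_span_pow_le_span_pow_mul hreg

end Quotient

theorem theorem4p2 {R : Type*} [CommRing R] [IsLocalRing R] (hdim : ringKrullDim R = 1)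
    (m : R) (hm : m ∈ IsLocalRing.maximalIdeal R) (hreg : m ∈ nonZeroDivisors R) :
    List.TFAE [
      IsStableRing R,
      IsFinitelyStableRing R ∧ IsStableIdeal (IsLocalRing.maximalIdeal R),
      IsQuadraticRing R ∧ HasAtMostTwoMaximalIdeals (integralClosure R (FractionRing R)),
      IsQuadraticExtension R (integralClosure R (FractionRing R)) ∧
        IsDedekindRegular (integralClosure R (FractionRing R)) ∧
        HasAtMostTwoMaximalIdeals (integralClosure R (FractionRing R)),
      IsStableRing (R ⧸ (⨅ i : ℕ, Ideal.span {m ^ i}))] := by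
  have hD : Ring.KrullDimLE 1 R := Ring.krullDimLE_iff.2 hdim.le
  have hM : IsRegularIdeal (maximalIdeal R) := ⟨m, hm, hreg⟩
  have : Nontrivial (FractionRing R) := (IsFractionRing.injective R (FractionRing R)).nontrivial
  tfae_have 1 → 2 := fun h => ⟨fun I _ hI => h I hI, h _ hM⟩
  tfae_have 2 → 3 := fun ⟨h, hs⟩ =>
    ⟨⟨inferInstance, h.isQuadraticExtension_jacobsonTowerUnion hm hreg, hs, hM⟩,
      h.hasAtMostTwoMaximalIdeals hm hreg⟩
  tfae_have 3 → 4 := by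
    rintro ⟨⟨_, hQ, hs, _⟩, h2⟩
    have hle : jacobsonTowerUnion R (FractionRing R) ≤ integralClosure R (FractionRing R) :=
      le_integralClosure_iff_isIntegral.2 hQ.isIntegral
    have hDed := hs.isDedekindRegular_jacobsonTowerUnion hM hQ <|
      h2.of_isIntegral (inclusion_isIntegral hle) (Subalgebra.inclusion_injective _)
    have heq := hle.antisymm hDed.integralClosure_le
    rw [heq] at hQ hDed
    exact ⟨hQ, hDed, h2⟩
  tfae_have 4 → 1 := fun ⟨hQ, hDed, h2⟩ => hQ.isStableRing hDed h2
  tfae_have 1 ↔ 5 := isStableRing_iff_quotient_iInf_span_pow hm hreg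
  tfae_finish
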